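/- Let $p$ be a prime, and let $M$ be a commutative monoid in the $\infty$-category $\mathcal S$ of spaces (that is, an $\mathbb E_\infty$-monoid, not assumed to be grouplike). Let $p\colon M\to M$ be multiplication by $p$, i.e. the composite of the diagonal $M\to M^p$ and the $p$-fold addition $M^p\to M$, and let $$\mathrm{tel}_p(M):=\mathrm{colim}\bigl(M\xrightarrow{\,p\,}M\xrightarrow{\,p\,}M\xrightarrow{\,p\,}\cdots\bigr)$$ be its $p$-telescope, the colimit being taken in the $\infty$-category of commutative monoids in $\mathcal S$. Then the canonical map $\mathrm{tel}_p(M)\to\pi_0(\mathrm{tel}_p(M))$ to the discrete space of connected components is an $\mathbb F_p$-homology isomorphism: it induces an isomorphism $$H_n(\mathrm{tel}_p(M);\mathbb F_p)\xrightarrow{\;\cong\;}H_n(\pi_0(\mathrm{tel}_p(M));\mathbb F_p)$$ for every $n\ge 0$. -/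

import Mathlib

open CategoryTheory Limits MonoidalCategory Simplicial

universe u

noncomputable section

/-- The category of finite pointed sets.  An object is a finite type `S`, standing for the pointed
set `S₊ = S ⊔ {*}`; every finite pointed set is of this form up to isomorphism. -/
structure FinPtd : Type 1 where
  /-- The non-basepoint elements. -/
  carrier : Type
  /-- There are finitely many of them. -/
  finite : Finite carrier

namespace FinPtd

instance (S : FinPtd) : Finite S.carrier := S.finite

/-- A pointed map `S₊ → T₊` is a function `f : S → Option T`, where `f s = none` means that
`s` is sent to the basepoint. -/
instance : Category FinPtd where
  Hom S T := S.carrier → Option T.carrier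
  id _ := some
  comp f g := fun s => (f s).bind g
  id_comp _ := rfl
  comp_id f := by funext s; exact Option.bind_fun_some (f s)
  assoc f g h := by funext s; exact Option.bind_assoc (f s) g h

/-- The pointed set `⟨1⟩ = {1}₊`. -/
def one : FinPtd := ⟨Unit, inferInstance⟩

open Classical in
/-- The inert map `S₊ → ⟨1⟩` that sends `s` to `1` and every other element to the basepoint. -/
def rho (S : FinPtd) (s : S.carrier) : S ⟶ one :=
  fun t => if t = s then some () else none

/-- The functor `S₊ ↦ S₊ ∧ {1, …, p}₊ = (S × {1, …, p})₊`, i.e. the `p`-fold wedge `⋁ₚ S₊`. -/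
def copies (p : ℕ) : FinPtd ⥤ FinPtd where
  obj S := ⟨S.carrier × Fin p, inferInstance⟩
  map {S T} f := fun x : S.carrier × Fin p => (f x.1).map fun t => ((t, x.2) : T.carrier × Fin p)
  map_id _ := rfl
  map_comp {S T U} f g := by
    funext x
    change ((f x.1).bind g).map (fun t => ((t, x.2) : U.carrier × Fin p)) =
      ((f x.1).map fun t => ((t, x.2) : T.carrier × Fin p)).bind
        (fun y : T.carrier × Fin p => (g y.1).map fun t => ((t, y.2) : U.carrier × Fin p))
    cases f x.1 <;> rfl

/-- The fold map `⋁ₚ S₊ → S₊`. -/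
def fold (p : ℕ) : copies p ⟶ 𝟭 FinPtd where
  app S := fun x : S.carrier × Fin p => some x.1
  naturality {S T} f := by
    funext x
    change ((f x.1).map fun t => ((t, x.2) : T.carrier × Fin p)).bind
      (fun y : T.carrier × Fin p => some y.1) = f x.1
    cases f x.1 <;> rfl

/-- The `i`-th collapse map `⋁ₚ S₊ → S₊`: the identity on the `i`-th wedge summand, and constant
on the others. -/
def collapse (p : ℕ) (i : Fin p) : copies p ⟶ 𝟭 FinPtd where
  app S := fun x : S.carrier × Fin p => if x.2 = i then some x.1 else none
  naturality {S T} f := by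
    funext x
    change ((f x.1).map fun t => ((t, x.2) : T.carrier × Fin p)).bind
      (fun y : T.carrier × Fin p => if y.2 = i then some y.1 else none) =
        (if x.2 = i then some x.1 else none).bind f
    by_cases h : x.2 = i <;> cases hx : f x.1 <;> simp [h, hx]

end FinPtd

/-- A map of simplicial sets is a (simplicial) homotopy equivalence.  Between Kan complexes these
are exactly the equivalences of the `∞`-category of spaces. -/
def SSet.IsHomotopyEquiv {X Y : SSet.{u}} (f : X ⟶ Y) : Prop :=
  ∃ g : Y ⟶ X, Nonempty (SSet.Homotopy (f ≫ g) (𝟙 X)) ∧ Nonempty (SSet.Homotopy (g ≫ f) (𝟙 Y))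

/-- Functors from finite pointed sets to simplicial sets. -/
abbrev GammaObj : Type (u + 1) := FinPtd ⥤ SSet.{u}

namespace GammaObj

variable (M : GammaObj.{u})

/-- The underlying simplicial set `M⟨1⟩`. -/
abbrev underlying : SSet.{u} := M.obj FinPtd.one

/-- The Segal map `M(S₊) → ∏_{s ∈ S} M⟨1⟩`, induced by the inert maps `S₊ → ⟨1⟩`. -/
def segalMap (S : FinPtd) : M.obj S ⟶ ∏ᶜ fun _ : S.carrier => M.underlying :=
  Pi.lift fun s => M.map (FinPtd.rho S s)

/-- The functor `S₊ ↦ M(⋁ₚ S₊)`. -/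
abbrev onCopies (p : ℕ) : GammaObj.{u} := FinPtd.copies p ⋙ M

/-- The `p`-fold power `Mᵖ`. -/
abbrev power (p : ℕ) : GammaObj.{u} := ∏ᶜ fun _ : Fin p => M

/-- The diagonal `M → Mᵖ`. -/
def diag (p : ℕ) : M ⟶ M.power p := Pi.lift fun _ => 𝟙 M

/-- The comparison map `M(⋁ₚ -) → Mᵖ` induced by the `p` collapse maps. It is a levelwise
homotopy equivalence when `M` is a commutative monoid. -/
def comparison (p : ℕ) : M.onCopies p ⟶ M.power p :=
  Pi.lift fun i => (Functor.whiskerRight (FinPtd.collapse p i) M : _ ⟶ 𝟭 FinPtd ⋙ M)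

/-- The addition `M(⋁ₚ -) → M` induced by the fold maps. -/
def add (p : ℕ) : M.onCopies p ⟶ M :=
  (Functor.whiskerRight (FinPtd.fold p) M : _ ⟶ 𝟭 FinPtd ⋙ M)

/-- The levelwise cylinder `M × Δ¹`. -/
abbrev cylinder : GammaObj.{u} := M ⋙ tensorRight (Δ[1] : SSet.{u})

/-- The inclusion of the end `0` of the cylinder. -/
def cyl₀ : M ⟶ M.cylinder where
  app S := SSet.ι₀

/-- The inclusion of the end `1` of the cylinder. -/
def cyl₁ : M ⟶ M.cylinder where
  app S := SSet.ι₁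

variable {M} in
/-- The homotopy coequalizer of two maps `a, b : X ⇉ Y`, formed levelwise: glue `X × Δ¹` to `Y`
by `a` at the end `0` and by `b` at the end `1`. -/
def hocoeq {X Y : GammaObj.{u}} (a b : X ⟶ Y) : GammaObj.{u} :=
  pushout (coprod.desc X.cyl₀ X.cyl₁) (coprod.desc a b)

/-- One side `∐ₖ (Mₖ ⨿ M(⋁ₚ -)ₖ)` of the gluing data of the telescope: one cylinder for each map
`Mₖ → Mᵖₖ`, and one for each span `Mᵖₖ ← M(⋁ₚ -)ₖ → Mₖ₊₁`. -/
abbrev telEdges (p : ℕ) : GammaObj.{u} := ∐ fun _ : ℕ => M ⨿ M.onCopies p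

/-- The other side `∐ₖ (Mₖ ⨿ Mᵖₖ)` of the gluing data of the telescope. -/
abbrev telVertices (p : ℕ) : GammaObj.{u} := ∐ fun _ : ℕ => M ⨿ M.power p

/-- The copy `Mₖ` of `M`. -/
def ιM (p k : ℕ) : M ⟶ M.telVertices p :=
  coprod.inl ≫ Sigma.ι (fun _ : ℕ => M ⨿ M.power p) k

/-- The copy `Mᵖₖ` of `Mᵖ`. -/
def ιPower (p k : ℕ) : M.power p ⟶ M.telVertices p :=
  coprod.inr ≫ Sigma.ι (fun _ : ℕ => M ⨿ M.power p) k

/-- Glues the end `0` of the cylinder on `Mₖ` to `Mₖ` by the identity, and the end `0` of the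
cylinder on `M(⋁ₚ -)ₖ` to `Mᵖₖ` by the comparison map. -/
def telLeft (p : ℕ) : M.telEdges p ⟶ M.telVertices p :=
  Sigma.desc fun k => coprod.desc (M.ιM p k) (M.comparison p ≫ M.ιPower p k)

/-- Glues the end `1` of the cylinder on `Mₖ` to `Mᵖₖ` by the diagonal, and the end `1` of the
cylinder on `M(⋁ₚ -)ₖ` to `Mₖ₊₁` by the addition. -/
def telRight (p : ℕ) : M.telEdges p ⟶ M.telVertices p :=
  Sigma.desc fun k => coprod.desc (M.diag p ≫ M.ιPower p k) (M.add p ≫ M.ιM p (k + 1))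

/-- The `p`-telescope `tel_p(M) = colim (M --p--> M --p--> M --p--> ⋯)`.

Multiplication by `p` on a commutative monoid `M` is the composite `M → Mᵖ → M` of the diagonal and
the addition; on a special `Γ`-space the addition is the span `Mᵖ ←≃- M(⋁ₚ -) → M` formed by the
comparison map and the fold map.  So the sequence is represented by the infinite zigzag
`M → Mᵖ ←≃- M(⋁ₚ -) → M → Mᵖ ←≃- M(⋁ₚ -) → M → ⋯` of strict maps, and `tel p M` is its homotopy
colimit (mapping telescope), formed levelwise.  As sequential colimits commute with finite products
in the `∞`-category of spaces, this levelwise homotopy colimit is also the colimit in commutative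
monoids. -/
def tel (p : ℕ) : GammaObj.{u} := hocoeq (M.telLeft p) (M.telRight p)

end GammaObj

/-- A commutative monoid in the `∞`-category of spaces (an `E_∞`-monoid), presented by a special
`Γ`-space: a functor from finite pointed sets to Kan complexes whose Segal maps
`M(S₊) → ∏_{s ∈ S} M⟨1⟩` are homotopy equivalences.  Group-likeness is not required. -/
structure CommMonoidSpace where
  /-- The functor `S₊ ↦ M(S₊)`. -/
  toFunctor : GammaObj.{u}
  /-- Its values are Kan complexes. -/
  kan : ∀ S : FinPtd, SSet.KanComplex (toFunctor.obj S)
  /-- The Segal condition. -/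
  segal : ∀ S : FinPtd, SSet.IsHomotopyEquiv (toFunctor.segalMap S)

/-- The `p`-telescope of a commutative monoid, again as a functor on finite pointed sets. -/
def CommMonoidSpace.tel (p : ℕ) (M : CommMonoidSpace.{u}) : GammaObj.{u} := M.toFunctor.tel p

namespace SSet

/-- The set `π₀ X` as a discrete (constant) simplicial set. -/
abbrev discretePi0 (X : SSet.{u}) : SSet.{u} := (SimplicialObject.const (Type u)).obj (π₀ X)

/-- All vertices of a simplex lie in the same connected component. -/
lemma pi0_mk_vertex {X : SSet.{u}} {n : SimplexCategory} (x : X.obj (Opposite.op n))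
    (i : Fin (n.len + 1)) :
    π₀.mk (X.map (SimplexCategory.const ⦋0⦌ n 0).op x) =
      π₀.mk (X.map (SimplexCategory.const ⦋0⦌ n i).op x) := by
  have e := π₀.sound (Edge.mk' (X.map (SimplexCategory.mkOfLe 0 i (Fin.zero_le i)).op x))
  rw [SimplicialObject.δ, SimplicialObject.δ, ← Functor.map_comp_apply, ← Functor.map_comp_apply,
    ← op_comp, ← op_comp] at e
  convert e using 4 <;> (congr 1; ext j; fin_cases j; rfl)

/-- The canonical map `X → π₀(X)`: a simplex is sent to the connected component of its
vertices. -/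
def toPi0 (X : SSet.{u}) : X ⟶ discretePi0 X where
  app n := ↾fun x => π₀.mk (X.map (SimplexCategory.const ⦋0⦌ n.unop 0).op x)
  naturality m n f := by
    ext x
    change π₀.mk (X.map _ (X.map f x)) = π₀.mk (X.map _ x)
    rw [← Functor.map_comp_apply, pi0_mk_vertex x (f.unop.toOrderHom 0)]
    rfl

/-- A map of simplicial sets is an `𝔽_p`-homology isomorphism if it induces isomorphisms on
simplicial homology with coefficients in `𝔽_p = ZMod p`, in all degrees. -/
def IsFpHomologyIso (p : ℕ) {X Y : SSet.{u}} (f : X ⟶ Y) : Prop :=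
  ∀ n : ℕ, IsIso (SSet.homologyMap f (ModuleCat.of (ZMod p) (ULift.{u} (ZMod p))) n)

end SSet

end

-- Let `X` be the underlying space, `μ : Xᵖ ⟶ X` the `p`-fold addition and `P` the diagonal followed
-- by `μ`. The homology of the telescope is the colimit of the homology of `X` along `P`. So the
-- point is that on mod `p` homology, in every positive degree, some power of `P` vanishes. The
-- telescope then has no homology in positive degrees, and its map to `π₀` is an isomorphism, with
-- inverse induced by a choice of one vertex per component.
--
-- Nilpotence (`exists_kills_pow`) needs only what `exists_add` provides: up to homotopy, `μ` is
-- invariant under permutations and commutes with `P`. Argue by induction on the degree `n ≥ 1`,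
-- with `Q` a power of `P` that vanishes in degrees strictly between `0` and `n`. On homology `P`
-- composed with `Qⁿ` is the diagonal, followed by `Qⁿ` on each of the `p` factors, followed by `μ`.
-- Let `r` collapse each component of `X` to a vertex. On chains `Qⁿ = a + b`, where `b = r ≫ Qⁿ`
-- factors through a discrete space and `a = uⁿ` for `u = (1 - r) ≫ Q`, which vanishes on homology
-- in all degrees below `n`, including `0` (`exists_pow_eq_add`).
--
-- Expand the `p`-fold external power of `a + b` over the subsets of the `p` factors. By symmetry of
-- `μ` a term depends only on the size of its subset, so the mixed terms come with coefficients
-- `p.choose m`, `0 < m < p`, and disappear mod `p`. The pure `b` term factors through a discrete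
-- space and vanishes in degree `n`. The pure `a` term is `a ⊗ a^(p-1)`; Künneth predicts its
-- vanishing in degree `n`, since `u` vanishes below `n` and the second factor vanishes in degree
-- `0`. This is `kills_tensMap_pow_of_kills_zero`, proved without Künneth by dimension shifting
-- along the décalage; one factor `u` is spent per degree, whence the exponent `n`.
--
-- For the telescope, a gluing of a cylinder along two maps has no homology in degree `n + 1` if the
-- difference of the maps is surjective on homology in degree `n + 1` and injective in degree `n`
-- (`cyc_le_bdry_of_isHocoeq`). Injectivity holds because the difference is triangular along the
-- zigzag; surjectivity holds because a class can be pushed along `P` until it dies.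

universe v

noncomputable section

/-! ### The naive homotopy category of simplicial sets and finite powers -/

namespace SSet

/-- The relation of simplicial homotopy on maps of simplicial sets. -/
def homotopyRel : HomRel SSet.{u} := fun _ _ f g => Nonempty (SSet.Homotopy f g)

/-- The naive homotopy category of simplicial sets. -/
abbrev Ho : Type (u + 1) := CategoryTheory.Quotient homotopyRel.{u}

/-- The projection to the naive homotopy category. -/
abbrev toHo : SSet.{u} ⥤ Ho.{u} := CategoryTheory.Quotient.functor _

lemma Homotopy.toHo_map_eq {X Y : SSet.{u}} {f g : X ⟶ Y} (h : Homotopy f g) :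
    toHo.map f = toHo.map g := CategoryTheory.Quotient.sound _ ⟨h⟩

lemma IsHomotopyEquiv.isIso_toHo_map {X Y : SSet.{u}} {f : X ⟶ Y} (hf : IsHomotopyEquiv f) :
    IsIso (toHo.map f) := by
  obtain ⟨g, ⟨h₁⟩, ⟨h₂⟩⟩ := hf
  refine ⟨toHo.map g, ?_, ?_⟩
  · rw [← Functor.map_comp, h₁.toHo_map_eq, CategoryTheory.Functor.map_id]
  · rw [← Functor.map_comp, h₂.toHo_map_eq, CategoryTheory.Functor.map_id]

/-- Homology is homotopy invariant, so it factors through the quotient category. -/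
lemma isIso_homologyMap_of_toHo {X Y : SSet.{u}} {f : X ⟶ Y} [h : IsIso (toHo.map f)]
    {C : Type*} [Category C] [Preadditive C] [HasCoproducts.{u} C] [CategoryWithHomology C]
    (R : C) (n : ℕ) : IsIso (SSet.homologyMap f R n) := by
  let F := CategoryTheory.Quotient.lift homotopyRel.{u} (SSet.homologyFunctor R n)
    (fun _ _ _ _ ⟨h⟩ => h.congr_homologyMap R n)
  exact inferInstanceAs (IsIso (F.map (toHo.map f)))

/-- The power `X ^ ι`, with `n`-simplices the functions from `ι` to the `n`-simplices of `X`. -/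
@[simps]
def pow (X : SSet.{u}) (ι : Type) : SSet.{u} where
  obj n := ι → X.obj n
  map f := ↾fun x i => X.map f (x i)

variable {X Y Z : SSet.{u}} {ι κ : Type}

/-- The projections of a power. -/
@[simps]
def powπ (X : SSet.{u}) (i : ι) : X.pow ι ⟶ X where
  app n := ↾fun x => x i

/-- The map to a power with given components. -/
@[simps]
def powLift (f : ι → (Y ⟶ X)) : Y ⟶ X.pow ι where
  app n := ↾fun y i => (f i).app n y
  naturality m n φ := by
    ext y
    funext i
    exact NatTrans.naturality_apply (f i) φ y

@[simp]
lemma powLift_π (f : ι → (Y ⟶ X)) (i : ι) : powLift f ≫ powπ X i = f i := rfl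

@[simp]
lemma powLift_π_assoc (f : ι → (Y ⟶ X)) (i : ι) (g : X ⟶ Z) :
    powLift f ≫ powπ X i ≫ g = f i ≫ g := rfl

lemma pow_hom_ext {f g : Y ⟶ X.pow ι} (h : ∀ i, f ≫ powπ X i = g ≫ powπ X i) : f = g := by
  ext n y
  funext i
  exact congr($(h i).app n y)

lemma comp_powLift (g : Z ⟶ Y) (f : ι → (Y ⟶ X)) :
    g ≫ powLift f = powLift fun i => g ≫ f i := rfl

lemma powLift_powπ (f : Y ⟶ X.pow ι) : powLift (fun i => f ≫ powπ X i) = f := rfl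

/-- Reindexing of powers. -/
abbrev powReindex (X : SSet.{u}) (σ : κ → ι) : X.pow ι ⟶ X.pow κ := powLift fun j => powπ X (σ j)

/-- The map of powers induced by a map. -/
abbrev powMap (f : X ⟶ Y) (ι : Type) : X.pow ι ⟶ Y.pow ι := powLift fun i => powπ X i ≫ f

/-- The diagonal of a power. -/
abbrev powDiag (X : SSet.{u}) (ι : Type) : X ⟶ X.pow ι := powLift fun _ => 𝟙 X

-- Equality in the quotient is generated by homotopies composed with maps on both sides. A single
-- such homotopy in coordinate `i` is combined with constant homotopies in the others.
open Classical in
lemma toHo_map_powLift_update (f : ι → (Y ⟶ X)) (i : ι) {φ ψ : Y ⟶ X}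
    (h : toHo.map φ = toHo.map ψ) :
    toHo.map (powLift (Function.update f i φ)) = toHo.map (powLift (Function.update f i ψ)) := by
  have h' := (CategoryTheory.Quotient.functor_homRel_eq_compClosure_eqvGen _ _ _).1 h
  clear h
  induction h' with
  | rel φ ψ h =>
    obtain ⟨_, _, a, f', g', b, ⟨h⟩⟩ := h
    refine Homotopy.toHo_map_eq
      { h := powLift (Function.update (fun j => CartesianMonoidalCategory.fst _ _ ≫ f j) i
          (a ▷ _ ≫ h.h ≫ b))
        h₀ := ?_, h₁ := ?_, rel := ?_ }
    · refine pow_hom_ext fun j => ?_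
      obtain rfl | hj := eq_or_ne j i
      · simp
      · simp [hj]
    · refine pow_hom_ext fun j => ?_
      obtain rfl | hj := eq_or_ne j i
      · simp
      · simp [hj]
    · ext n x
      exact x.1.2.elim
  | refl => rfl
  | symm _ _ _ ih => exact ih.symm
  | trans _ _ _ _ _ h₁ h₂ => exact h₁.trans h₂

-- Coordinates are exchanged one at a time: each may require its own zigzag of homotopies, which is
-- why `ι` is finite. No fibrancy is involved.
open Classical in
lemma toHo_map_eq_of_powπ [Finite ι] {f g : Y ⟶ X.pow ι}
    (h : ∀ i, toHo.map (f ≫ powπ X i) = toHo.map (g ≫ powπ X i)) : toHo.map f = toHo.map g := by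
  have := Fintype.ofFinite ι
  suffices ∀ s : Finset ι, toHo.map (powLift (s.piecewise (fun i => f ≫ powπ X i)
      (fun i => g ≫ powπ X i))) = toHo.map g by
    simpa [powLift_powπ] using this Finset.univ
  intro s
  induction s using Finset.induction_on with
  | empty => simp [powLift_powπ]
  | insert i s hi ih =>
    rw [Finset.piecewise_insert, toHo_map_powLift_update _ _ (h i), ← ih]
    congr 2
    rw [Function.update_eq_self_iff]
    simp [hi]

end SSet

namespace SSet

variable {X Y : SSet.{u}} {ι κ : Type}

/-- The comparison of the explicit power with the categorical product. -/
def piIsoPow (X : SSet.{u}) (ι : Type) : (∏ᶜ fun _ : ι => X) ≅ X.pow ι where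
  hom := powLift fun i => Pi.π (fun _ : ι => X) i
  inv := Pi.lift fun i => powπ X i
  hom_inv_id := Pi.hom_ext _ _ fun i => by simp
  inv_hom_id := pow_hom_ext fun i => by simp

lemma isIso_toHo_map_powMap [Finite ι] (f : X ⟶ Y) [IsIso (toHo.map f)] :
    IsIso (toHo.map (powMap f ι)) := by
  obtain ⟨g, hg⟩ := toHo.map_surjective (inv (toHo.map f))
  have h₁ : toHo.map (f ≫ g) = toHo.map (𝟙 X) := by
    rw [CategoryTheory.Functor.map_comp, CategoryTheory.Functor.map_id, hg, IsIso.hom_inv_id]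
  have h₂ : toHo.map (g ≫ f) = toHo.map (𝟙 Y) := by
    rw [CategoryTheory.Functor.map_comp, CategoryTheory.Functor.map_id, hg, IsIso.inv_hom_id]
  refine ⟨toHo.map (powMap g ι), ?_, ?_⟩
  · rw [← CategoryTheory.Functor.map_comp, ← CategoryTheory.Functor.map_id]
    refine toHo_map_eq_of_powπ fun i => ?_
    rw [show (powMap f ι ≫ powMap g ι) ≫ powπ X i = powπ X i ≫ (f ≫ g) from rfl,
      CategoryTheory.Functor.map_comp, h₁, ← CategoryTheory.Functor.map_comp,
      Category.comp_id, Category.id_comp]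
  · rw [← CategoryTheory.Functor.map_comp, ← CategoryTheory.Functor.map_id]
    refine toHo_map_eq_of_powπ fun i => ?_
    rw [show (powMap g ι ≫ powMap f ι) ≫ powπ Y i = powπ Y i ≫ (g ≫ f) from rfl,
      CategoryTheory.Functor.map_comp, h₂, ← CategoryTheory.Functor.map_comp,
      Category.comp_id, Category.id_comp]

end SSet

open SSet

/-! ### The addition of a special Γ-space up to homotopy -/

namespace GammaObj

variable (F : GammaObj.{u})

/-- The Segal map with values in the explicit power. -/
def segalPow (S : FinPtd) : F.obj S ⟶ F.underlying.pow S.carrier :=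
  powLift fun s => F.map (FinPtd.rho S s)

lemma segalMap_comp_piIsoPow (S : FinPtd) :
    F.segalMap S ≫ (piIsoPow F.underlying S.carrier).hom = F.segalPow S :=
  pow_hom_ext fun i => by simp [segalMap, segalPow, piIsoPow]

/-- The comparison map `F(⋁ₚ S₊) ⟶ F(S₊)ᵖ` with values in the explicit power. -/
def comparisonPow (p : ℕ) (S : FinPtd) :
    F.obj ((FinPtd.copies p).obj S) ⟶ (F.obj S).pow (Fin p) :=
  powLift fun i => F.map ((FinPtd.collapse p i).app S)

/-- The addition `F(⋁ₚ S₊) ⟶ F(S₊)`. -/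
def foldMap (p : ℕ) (S : FinPtd) : F.obj ((FinPtd.copies p).obj S) ⟶ F.obj S :=
  F.map ((FinPtd.fold p).app S)

variable {F}

lemma foldMap_naturality (p : ℕ) {S T : FinPtd} (f : S ⟶ T) :
    F.map ((FinPtd.copies p).map f) ≫ F.foldMap p T = F.foldMap p S ≫ F.map f := by
  rw [foldMap, foldMap, ← CategoryTheory.Functor.map_comp, ← CategoryTheory.Functor.map_comp]
  exact congrArg F.map ((FinPtd.fold p).naturality f)

lemma comparisonPow_naturality (p : ℕ) {S T : FinPtd} (f : S ⟶ T) :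
    F.map ((FinPtd.copies p).map f) ≫ F.comparisonPow p T =
      F.comparisonPow p S ≫ powMap (F.map f) (Fin p) := by
  refine pow_hom_ext fun i => ?_
  change F.map _ ≫ F.map _ = F.map _ ≫ F.map _
  rw [← CategoryTheory.Functor.map_comp, ← CategoryTheory.Functor.map_comp]
  exact congrArg F.map ((FinPtd.collapse p i).naturality f)

lemma _root_.FinPtd.collapse_comp_rho (p : ℕ) (S : FinPtd) (s : S.carrier) (i : Fin p) :
    (FinPtd.collapse p i).app S ≫ FinPtd.rho S s =
      FinPtd.rho ((FinPtd.copies p).obj S) (s, i) := by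
  funext ⟨t, j⟩
  change (if j = i then some t else none).bind (FinPtd.rho S s) = _
  change _ = @ite _ (((t, j) : S.carrier × Fin p) = (s, i)) (Classical.propDecidable _) (some ()) none
  by_cases h : j = i <;> by_cases h' : t = s <;> simp [h, h', FinPtd.rho] <;> rfl

end GammaObj

namespace CommMonoidSpace

variable (M : CommMonoidSpace.{u})

lemma isIso_segalPow (S : FinPtd) : IsIso (toHo.map (M.toFunctor.segalPow S)) := by
  have := (M.segal S).isIso_toHo_map
  rw [← GammaObj.segalMap_comp_piIsoPow, CategoryTheory.Functor.map_comp]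
  infer_instance

/-- Two out of three: the comparison map followed by the power of the Segal map of `S` is, after
reindexing, the Segal map of the `p`-fold wedge. -/
instance isIso_comparisonPow (p : ℕ) (S : FinPtd) :
    IsIso (toHo.map (M.toFunctor.comparisonPow p S)) := by
  have := M.isIso_segalPow S
  have := M.isIso_segalPow ((FinPtd.copies p).obj S)
  have := isIso_toHo_map_powMap (ι := Fin p) (M.toFunctor.segalPow S)
  let e : (M.toFunctor.underlying.pow S.carrier).pow (Fin p) ≅
      M.toFunctor.underlying.pow (S.carrier × Fin p) :=
    { hom := powLift fun x => powπ _ x.2 ≫ powπ _ x.1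
      inv := powLift fun i => powLift fun s => powπ _ (s, i)
      hom_inv_id := rfl
      inv_hom_id := rfl }
  have h : M.toFunctor.comparisonPow p S ≫ powMap (M.toFunctor.segalPow S) (Fin p) ≫ e.hom =
      M.toFunctor.segalPow ((FinPtd.copies p).obj S) := by
    refine pow_hom_ext fun x => ?_
    change M.toFunctor.map _ ≫ M.toFunctor.map _ = M.toFunctor.map _
    rw [← CategoryTheory.Functor.map_comp, FinPtd.collapse_comp_rho]
  have h' : IsIso (toHo.map (M.toFunctor.comparisonPow p S) ≫
      toHo.map (powMap (M.toFunctor.segalPow S) (Fin p) ≫ e.hom)) := by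
    rw [← CategoryTheory.Functor.map_comp, h]
    assumption
  have : IsIso (toHo.map (powMap (M.toFunctor.segalPow S) (Fin p) ≫ e.hom)) := by
    rw [CategoryTheory.Functor.map_comp]
    have : IsIso (toHo.map e.hom) := (toHo.mapIso e).isIso_hom
    exact IsIso.comp_isIso
  exact IsIso.of_isIso_comp_right _ (toHo.map (powMap (M.toFunctor.segalPow S) (Fin p) ≫ e.hom))

/-- The `p`-fold addition in the homotopy category. -/
def hoAdd (p : ℕ) (S : FinPtd) :
    toHo.obj ((M.toFunctor.obj S).pow (Fin p)) ⟶ toHo.obj (M.toFunctor.obj S) :=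
  inv (toHo.map (M.toFunctor.comparisonPow p S)) ≫ toHo.map (M.toFunctor.foldMap p S)

lemma hoAdd_naturality (p : ℕ) {S T : FinPtd} (f : S ⟶ T) :
    M.hoAdd p S ≫ toHo.map (M.toFunctor.map f) =
      toHo.map (powMap (M.toFunctor.map f) (Fin p)) ≫ M.hoAdd p T := by
  rw [hoAdd, hoAdd, Category.assoc, ← CategoryTheory.Functor.map_comp,
    ← GammaObj.foldMap_naturality, IsIso.inv_comp_eq, ← CategoryTheory.Functor.map_comp_assoc,
    ← GammaObj.comparisonPow_naturality, CategoryTheory.Functor.map_comp_assoc,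
    IsIso.hom_inv_id_assoc, CategoryTheory.Functor.map_comp]

/-- Multiplication by `p` in the homotopy category. -/
def hoMul (p : ℕ) (S : FinPtd) : toHo.obj (M.toFunctor.obj S) ⟶ toHo.obj (M.toFunctor.obj S) :=
  toHo.map (powDiag _ (Fin p)) ≫ M.hoAdd p S

lemma hoMul_naturality (p : ℕ) {S T : FinPtd} (f : S ⟶ T) :
    M.hoMul p S ≫ toHo.map (M.toFunctor.map f) = toHo.map (M.toFunctor.map f) ≫ M.hoMul p T := by
  rw [hoMul, hoMul, Category.assoc, hoAdd_naturality, ← CategoryTheory.Functor.map_comp_assoc,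
    ← CategoryTheory.Functor.map_comp_assoc]
  rfl

/-- The fold and collapse maps come from finite pointed sets, and multiplication by `p` is natural
in these. So multiplication by `p` on the wedge corresponds to `P` on each factor, and it commutes
with the fold; this is where commutativity of the addition enters. -/
lemma hoAdd_comp_hoMul (p : ℕ) (P : M.toFunctor.underlying ⟶ M.toFunctor.underlying)
    (hP : toHo.map P = M.hoMul p FinPtd.one) :
    M.hoAdd p FinPtd.one ≫ M.hoMul p FinPtd.one =
      toHo.map (powMap P (Fin p)) ≫ M.hoAdd p FinPtd.one := by
  obtain ⟨P', hP'⟩ := toHo.map_surjective (M.hoMul p ((FinPtd.copies p).obj FinPtd.one))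
  have h : toHo.map (P' ≫ M.toFunctor.comparisonPow p FinPtd.one) =
      toHo.map (M.toFunctor.comparisonPow p FinPtd.one ≫ powMap P (Fin p)) := by
    refine toHo_map_eq_of_powπ fun i => ?_
    change toHo.map (P' ≫ M.toFunctor.map ((FinPtd.collapse p i).app FinPtd.one)) =
      toHo.map (M.toFunctor.map ((FinPtd.collapse p i).app FinPtd.one) ≫ P)
    rw [CategoryTheory.Functor.map_comp, CategoryTheory.Functor.map_comp, hP, hP']
    exact M.hoMul_naturality p _
  rw [hoAdd, Category.assoc, GammaObj.foldMap]
  erw [← M.hoMul_naturality p]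
  rw [← hP', IsIso.inv_comp_eq, ← CategoryTheory.Functor.map_comp_assoc, ← h,
    CategoryTheory.Functor.map_comp_assoc, IsIso.hom_inv_id_assoc]

/-- A permutation of the factors is realised by a permutation `τ` of the wedge summands, which the
fold map does not see. Powers are contravariant in the index, hence `σ.symm` in `τ`. -/
lemma powReindex_comp_hoAdd (p : ℕ) (σ : Equiv.Perm (Fin p)) (S : FinPtd) :
    toHo.map (powReindex _ σ) ≫ M.hoAdd p S = M.hoAdd p S := by
  let τ : (FinPtd.copies p).obj S ⟶ (FinPtd.copies p).obj S :=
    fun x : S.carrier × Fin p => some ((x.1, σ.symm x.2) : S.carrier × Fin p)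
  have h₁ : M.toFunctor.map τ ≫ M.toFunctor.foldMap p S = M.toFunctor.foldMap p S := by
    rw [GammaObj.foldMap, ← CategoryTheory.Functor.map_comp]
    rfl
  have h₂ : M.toFunctor.map τ ≫ M.toFunctor.comparisonPow p S =
      M.toFunctor.comparisonPow p S ≫ powReindex _ σ := by
    refine pow_hom_ext fun i => ?_
    change M.toFunctor.map _ ≫ M.toFunctor.map _ = M.toFunctor.map _
    rw [← CategoryTheory.Functor.map_comp]
    congr 1
    funext ⟨s, j⟩
    change (if σ.symm j = i then some s else none) = if j = σ i then some s else none
    simp only [Equiv.symm_apply_eq]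
  rw [hoAdd, ← Category.assoc, IsIso.eq_inv_comp, ← Category.assoc, ← Category.assoc,
    ← CategoryTheory.Functor.map_comp, ← h₂, CategoryTheory.Functor.map_comp, Category.assoc,
    Category.assoc, IsIso.hom_inv_id_assoc, ← CategoryTheory.Functor.map_comp, h₁]

/-- A commutative monoid has a strictly defined `p`-fold addition, with the expected properties up
to homotopy. -/
theorem exists_add (p : ℕ) : ∃ μ : M.toFunctor.underlying.pow (Fin p) ⟶ M.toFunctor.underlying,
    toHo.map (M.toFunctor.comparisonPow p FinPtd.one ≫ μ) =
      toHo.map (M.toFunctor.foldMap p FinPtd.one) ∧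
    toHo.map (μ ≫ powDiag _ (Fin p) ≫ μ) =
      toHo.map (powMap (powDiag _ (Fin p) ≫ μ) (Fin p) ≫ μ) ∧
    ∀ σ : Equiv.Perm (Fin p), toHo.map (powReindex _ σ ≫ μ) = toHo.map μ := by
  obtain ⟨μ, hμ⟩ := toHo.map_surjective (M.hoAdd p FinPtd.one)
  have h := M.hoAdd_comp_hoMul p (powDiag _ (Fin p) ≫ μ) (by
    rw [CategoryTheory.Functor.map_comp, hμ]; rfl)
  refine ⟨μ, ?_, ?_, fun σ => ?_⟩
  · rw [CategoryTheory.Functor.map_comp, hμ, hoAdd, IsIso.hom_inv_id_assoc]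
  · rw [CategoryTheory.Functor.map_comp, CategoryTheory.Functor.map_comp,
      CategoryTheory.Functor.map_comp toHo (powMap _ _), hμ, ← h, hoMul]
  · rw [CategoryTheory.Functor.map_comp, hμ, powReindex_comp_hoAdd]

end CommMonoidSpace

/-! ### Décalage and its extra degeneracy -/

namespace SimplexCategory

/-- The functor `[0] ⋆ -` that adds a new initial vertex. -/
@[reducible] def addInit : SimplexCategory ⥤ SimplexCategory where
  obj n := ⦋n.len + 1⦌
  map {m n} f := Hom.mk
    { toFun := Fin.cases 0 fun i => (f.toOrderHom i).succ
      monotone' := fun i j hij => by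
        induction i using Fin.cases with
        | zero => exact Fin.zero_le _
        | succ i =>
          induction j using Fin.cases with
          | zero => exact absurd hij (by simp)
          | succ j => simpa using f.toOrderHom.monotone (Fin.succ_le_succ_iff.1 hij) }
  map_id n := by
    ext i : 3
    induction i using Fin.cases <;> rfl
  map_comp f g := by
    ext i : 3
    induction i using Fin.cases <;> rfl

lemma addInit_map_δ {n : ℕ} (i : Fin (n + 2)) : addInit.map (δ i) = δ i.succ := by
  ext j : 3
  induction j using Fin.cases with
  | zero => exact (Fin.succ_succAbove_zero i).symm
  | succ j => exact (Fin.succ_succAbove_succ i j).symm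

lemma addInit_map_σ {n : ℕ} (i : Fin (n + 1)) : addInit.map (σ i) = σ i.succ := by
  ext j : 3
  induction j using Fin.cases with
  | zero => exact (Fin.predAbove_right_zero (i := i.succ)).symm
  | succ j => exact (Fin.succ_predAbove_succ i j).symm

end SimplexCategory

namespace CategoryTheory.SimplicialObject

variable {C : Type*} [Category C] (X Y : SimplicialObject C)

open Opposite

lemma map_op_comp_map_op {a b b' c : SimplexCategory} {f : b ⟶ a} {g : c ⟶ b} {f' : b' ⟶ a}
    {g' : c ⟶ b'} (h : g ≫ f = g' ≫ f') :
    X.map f.op ≫ X.map g.op = X.map f'.op ≫ X.map g'.op := by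
  rw [← X.map_comp, ← X.map_comp, ← op_comp, ← op_comp, h]

lemma map_op_comp_map_op_eq {a b c : SimplexCategory} {f : b ⟶ a} {g : c ⟶ b} {h : c ⟶ a}
    (e : g ≫ f = h) : X.map f.op ≫ X.map g.op = X.map h.op := by
  rw [← X.map_comp, ← op_comp, e]

lemma map_op_comp_map_op_eq_id {a b : SimplexCategory} {f : b ⟶ a} {g : a ⟶ b}
    (e : g ≫ f = 𝟙 a) : X.map f.op ≫ X.map g.op = 𝟙 _ := by
  rw [← X.map_comp, ← op_comp, e, op_id, X.map_id]

/-- The décalage of a simplicial object, forgetting the face `0`. -/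
@[reducible] def dec : SimplicialObject C := SimplexCategory.addInit.op ⋙ X

lemma dec_δ {n : ℕ} (i : Fin (n + 2)) : X.dec.δ i = X.δ i.succ :=
  congrArg (fun f : _ ⟶ _ => X.map f.op) (SimplexCategory.addInit_map_δ i)

lemma dec_σ {n : ℕ} (i : Fin (n + 1)) : X.dec.σ i = X.σ i.succ :=
  congrArg (fun f : _ ⟶ _ => X.map f.op) (SimplexCategory.addInit_map_σ i)

/-- The map from the décalage given by the forgotten face. -/
def decε : X.dec ⟶ X where
  app n := X.δ (n := n.unop.len) 0
  naturality m n f := by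
    exact X.map_op_comp_map_op rfl

/-- The décalage, augmented towards the object of vertices by the initial vertex. -/
@[reducible] def decAug : Augmented C where
  left := X.dec
  right := X _⦋0⦌
  hom :=
    { app n := X.map (SimplexCategory.const ⦋0⦌ (SimplexCategory.addInit.obj n.unop) 0).op
      naturality m n f := by
        refine (X.map_op_comp_map_op_eq ?_).trans (Category.comp_id _).symm
        ext i : 3
        rfl }

/-- The extra degeneracy of the décalage. -/
def decExtraDegeneracy : X.decAug.ExtraDegeneracy where
  s' := X.σ 0
  s n := X.σ (n := n + 1) 0
  s'_comp_ε := by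
    refine X.map_op_comp_map_op_eq_id ?_
    ext i : 3
    fin_cases i
    rfl
  s₀_comp_δ₁ := by
    change X.σ 0 ≫ X.dec.δ 1 = X.map _ ≫ X.σ 0
    rw [dec_δ]
    refine X.map_op_comp_map_op ?_
    ext i : 3
    fin_cases i <;> rfl
  s_comp_δ₀ n := by
    change X.σ 0 ≫ X.dec.δ 0 = 𝟙 _
    rw [dec_δ]
    exact X.δ_comp_σ_succ (i := 0)
  s_comp_δ n i := by
    change X.σ 0 ≫ X.dec.δ _ = X.dec.δ _ ≫ X.σ 0
    rw [dec_δ, dec_δ]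
    exact X.δ_comp_σ_of_gt (i := i.succ) (j := 0) (by simp)
  s_comp_σ n i := by
    change X.σ 0 ≫ X.dec.σ _ = X.dec.σ _ ≫ X.σ 0
    rw [dec_σ, dec_σ]
    exact (X.σ_comp_σ (i := 0) (j := i.succ) (by simp)).symm

variable {X}

/-- The map from a constant simplicial object given by a map to the vertices. -/
def constHom {V : C} (v : V ⟶ X _⦋0⦌) : (SimplicialObject.const C).obj V ⟶ X where
  app n := v ≫ X.map (SimplexCategory.const n.unop ⦋0⦌ 0).op
  naturality m n f := by
    change 𝟙 _ ≫ _ = (_ ≫ _) ≫ _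
    rw [Category.assoc, ← X.map_comp, Category.id_comp]
    rfl

lemma const_hom_ext {V : C} {f g : (SimplicialObject.const C).obj V ⟶ X}
    (h : f.app (op ⦋0⦌) = g.app (op ⦋0⦌)) : f = g := by
  ext n
  have hf := f.naturality (SimplexCategory.const n.unop ⦋0⦌ 0).op
  have hg := g.naturality (SimplexCategory.const n.unop ⦋0⦌ 0).op
  have e : ((SimplicialObject.const C).obj V).map (SimplexCategory.const n.unop ⦋0⦌ 0).op =
    𝟙 V := rfl
  rw [e] at hf hg
  rw [← Category.id_comp (f.app n), ← Category.id_comp (g.app n)]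
  exact hf.trans (by rw [h]; exact hg.symm)

lemma constHom_app_zero {V : C} (v : V ⟶ X _⦋0⦌) : (constHom v).app (op ⦋0⦌) = v := by
  change v ≫ X.map _ = v
  convert Category.comp_id v
  convert X.map_id _
  rw [← op_id]
  congr 1
  ext i : 3
  fin_cases i
  rfl

lemma constHom_dec_comp_decε {V : C} (c : V ⟶ X _⦋1⦌) :
    (constHom (X := X.dec) c ≫ X.decε) = constHom (c ≫ X.δ 0) := by
  refine const_hom_ext ?_
  rw [constHom_app_zero]
  exact congrArg (· ≫ X.δ 0) (constHom_app_zero (X := X.dec) c)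

/-- The composite of the augmentation of the décalage and the section of the extra degeneracy. -/
def decRetract : X.dec ⟶ X.dec := X.decAug.hom ≫ X.decExtraDegeneracy.section_

/-- The identity of the décalage is homotopic to a map that factors through a constant object. -/
def decHomotopy : SimplicialObject.Homotopy (decRetract (X := X)) (𝟙 X.dec) :=
  X.decExtraDegeneracy.homotopy

/-- Contracting the décalage to its initial vertices and then mapping to `X` only sees the vertices
of `X`. -/
lemma decRetract_comp_decε :
    decRetract (X := X) ≫ X.decε = X.decAug.hom ≫ constHom (𝟙 (X _⦋0⦌)) := by
  have h : X.decExtraDegeneracy.section_ ≫ X.decε = constHom (𝟙 (X _⦋0⦌)) := by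
    refine const_hom_ext ?_
    rw [constHom_app_zero]
    refine Eq.trans ?_ (X.δ_comp_σ_self (i := 0))
    exact congrArg (· ≫ X.δ 0) X.decExtraDegeneracy.section_app_op_mk_zero
  exact (Category.assoc _ _ _).trans (congrArg (X.decAug.hom ≫ ·) h)

lemma constHom_comp_decAug_hom {V : C} (c : V ⟶ X _⦋1⦌) :
    constHom (X := X.dec) c ≫ X.decAug.hom = (SimplicialObject.const C).map (c ≫ X.δ 1) := by
  refine const_hom_ext ?_
  refine (congrArg (· ≫ _) (constHom_app_zero (X := X.dec) c)).trans ?_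
  refine congrArg (c ≫ ·) (congrArg X.map (congrArg Quiver.Hom.op ?_))
  ext i : 3
  fin_cases i
  rfl

lemma const_map_comp_constHom {V W : C} (f : V ⟶ W) (v : W ⟶ X _⦋0⦌) :
    (SimplicialObject.const C).map f ≫ constHom v = constHom (f ≫ v) := by
  refine const_hom_ext ?_
  rw [constHom_app_zero]
  exact congrArg (f ≫ ·) (constHom_app_zero v)

/-- The maps from a constant simplicial object given by the two ends of a family of edges are
homotopic. -/
def constHomHomotopy {V : C} (c : V ⟶ X _⦋1⦌) :
    SimplicialObject.Homotopy (constHom (c ≫ X.δ 1)) (constHom (c ≫ X.δ 0)) := by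
  -- A family of edges is a constant family of vertices of the décalage; the contraction moves each
  -- edge to its initial vertex, so its image in `X` joins the two ends.
  have H := (decHomotopy.precomp (constHom (X := X.dec) c)).postcomp X.decε
  rwa [Category.assoc, decRetract_comp_decε, ← Category.assoc, constHom_comp_decAug_hom,
    const_map_comp_constHom, Category.comp_id, Category.comp_id, constHom_dec_comp_decε] at H

end CategoryTheory.SimplicialObject

/-! ### Cycles, boundaries and maps vanishing on homology -/

namespace ChainComplex

section

variable {k : Type v} [Ring k] {C D E : ChainComplex (ModuleCat.{u} k) ℕ}

/-- The cycles of a chain complex of modules, as a submodule. -/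
def cyc (C : ChainComplex (ModuleCat.{u} k) ℕ) (n : ℕ) : Submodule k (C.X n) :=
  LinearMap.ker (C.d n (n - 1)).hom

/-- The boundaries of a chain complex of modules, as a submodule. -/
def bdry (C : ChainComplex (ModuleCat.{u} k) ℕ) (n : ℕ) : Submodule k (C.X n) :=
  LinearMap.range (C.d (n + 1) n).hom

lemma mem_cyc {n : ℕ} {z : C.X n} : z ∈ C.cyc n ↔ C.d n (n - 1) z = 0 := Iff.rfl

/-- In degree `0` the truncated `n - 1` is again `0`, and the component `d 0 0` is zero because the
shape does not relate these degrees. -/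
lemma mem_cyc_zero (z : C.X 0) : z ∈ C.cyc 0 := by
  rw [mem_cyc, C.shape _ _ (by simp)]
  rfl

lemma d_mem_bdry {n : ℕ} (w : C.X (n + 1)) : C.d (n + 1) n w ∈ C.bdry n := ⟨w, rfl⟩

lemma d_f_apply (f : C ⟶ D) (m n : ℕ) (z : C.X m) : D.d m n (f.f m z) = f.f n (C.d m n z) :=
  congr($(f.comm m n) z)

lemma map_mem_cyc (f : C ⟶ D) {n : ℕ} {z : C.X n} (hz : z ∈ C.cyc n) : f.f n z ∈ D.cyc n := by
  rw [mem_cyc] at *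
  rw [d_f_apply, hz, map_zero]

lemma map_mem_bdry (f : C ⟶ D) {n : ℕ} {z : C.X n} (hz : z ∈ C.bdry n) : f.f n z ∈ D.bdry n := by
  obtain ⟨w, rfl⟩ := hz
  exact ⟨f.f (n + 1) w, d_f_apply f _ _ w⟩

/-- A map of chain complexes of modules that vanishes on homology in degree `n`. -/
def Kills (f : C ⟶ D) (n : ℕ) : Prop := ∀ z ∈ C.cyc n, f.f n z ∈ D.bdry n

lemma next_eq (n : ℕ) : (ComplexShape.down ℕ).next n = n - 1 := by
  cases n <;> simp

/-- The homology class of a cycle. -/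
def cls (C : ChainComplex (ModuleCat.{u} k) ℕ) (n : ℕ) :
    ModuleCat.of k (C.cyc n) ⟶ C.homology n :=
  C.liftCycles (ModuleCat.ofHom (C.cyc n).subtype) (n - 1) (next_eq n)
    (ModuleCat.hom_ext (LinearMap.ext fun z => z.2)) ≫ C.homologyπ n

lemma cls_surjective (n : ℕ) : Function.Surjective (C.cls n) := by
  intro x
  obtain ⟨y, rfl⟩ := (ModuleCat.epi_iff_surjective (C.homologyπ n)).1 inferInstance x
  refine ⟨⟨C.iCycles n y, congr($(C.iCycles_d n (n - 1)) y)⟩, ?_⟩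
  rw [cls, ModuleCat.comp_apply]
  congr 1
  apply (ModuleCat.mono_iff_injective (C.iCycles n)).1 inferInstance
  rw [← ModuleCat.comp_apply, HomologicalComplex.liftCycles_i]
  rfl

lemma cls_eq_zero_iff {n : ℕ} (z : C.cyc n) : C.cls n z = 0 ↔ (z : C.X n) ∈ C.bdry n := by
  have hi : C.iCycles n (C.liftCycles (ModuleCat.ofHom (C.cyc n).subtype) (n - 1) (next_eq n)
      (ModuleCat.hom_ext (LinearMap.ext fun z => z.2)) z) = z := by
    rw [← ModuleCat.comp_apply, HomologicalComplex.liftCycles_i]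
    rfl
  have hex := ShortComplex.exact_of_g_is_cokernel
    (ShortComplex.mk _ _ (C.toCycles_comp_homologyπ (n + 1) n))
    (C.homologyIsCokernel (n + 1) n (by simp))
  rw [ShortComplex.moduleCat_exact_iff] at hex
  rw [cls, ModuleCat.comp_apply]
  constructor
  · intro h
    obtain ⟨w, hw⟩ := hex _ h
    refine ⟨w, ?_⟩
    rw [← hi, ← hw]
    exact congr($(C.toCycles_i (n + 1) n) w).symm
  · rintro ⟨w, hw⟩
    rw [← ModuleCat.comp_apply]
    have : C.liftCycles (ModuleCat.ofHom (C.cyc n).subtype) (n - 1) (next_eq n)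
      (ModuleCat.hom_ext (LinearMap.ext fun z => z.2)) z = C.toCycles (n + 1) n w := by
      apply (ModuleCat.mono_iff_injective (C.iCycles n)).1 inferInstance
      rw [hi, ← hw]
      exact congr($(C.toCycles_i (n + 1) n) w).symm
    rw [ModuleCat.comp_apply, this]
    exact congr($(C.toCycles_comp_homologyπ (n + 1) n) w)

lemma homologyMap_cls (f : C ⟶ D) {n : ℕ} (z : C.cyc n) :
    HomologicalComplex.homologyMap f n (C.cls n z) =
      D.cls n ⟨f.f n z, map_mem_cyc f z.2⟩ := by
  rw [cls, cls, ModuleCat.comp_apply, ModuleCat.comp_apply, ← ModuleCat.comp_apply (C.homologyπ n),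
    HomologicalComplex.homologyπ_naturality, ModuleCat.comp_apply]
  congr 1
  rw [← ModuleCat.comp_apply, HomologicalComplex.liftCycles_comp_cyclesMap]
  apply (ModuleCat.mono_iff_injective (D.iCycles n)).1 inferInstance
  rw [← ModuleCat.comp_apply, ← ModuleCat.comp_apply, HomologicalComplex.liftCycles_i,
    HomologicalComplex.liftCycles_i]
  rfl

lemma kills_iff (f : C ⟶ D) (n : ℕ) :
    Kills f n ↔ HomologicalComplex.homologyMap f n = 0 := by
  constructor
  · intro h
    refine ModuleCat.hom_ext (LinearMap.ext fun x => ?_)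
    obtain ⟨z, rfl⟩ := C.cls_surjective n x
    exact (homologyMap_cls f z).trans ((cls_eq_zero_iff _).2 (h z z.2))
  · intro h z hz
    rw [← cls_eq_zero_iff ⟨_, map_mem_cyc f hz⟩, ← homologyMap_cls f ⟨z, hz⟩, h]
    rfl

lemma kills_sub_iff (f g : C ⟶ D) (n : ℕ) :
    Kills (f - g) n ↔
      HomologicalComplex.homologyMap f n = HomologicalComplex.homologyMap g n := by
  rw [kills_iff, HomologicalComplex.homologyMap_sub, sub_eq_zero]

lemma _root_.Homotopy.kills_sub {f g : C ⟶ D} (h : Homotopy f g) (n : ℕ) : Kills (f - g) n :=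
  (kills_sub_iff f g n).2 (h.homologyMap_eq n)

lemma Kills.comp_left {f : C ⟶ D} {n : ℕ} (h : Kills f n) (g : D ⟶ E) : Kills (f ≫ g) n :=
  fun z hz => map_mem_bdry g (h z hz)

lemma Kills.comp_right {g : D ⟶ E} {n : ℕ} (h : Kills g n) (f : C ⟶ D) : Kills (f ≫ g) n :=
  fun _ hz => h _ (map_mem_cyc f hz)

lemma Kills.sub {f g : C ⟶ D} {n : ℕ} (hf : Kills f n) (hg : Kills g n) : Kills (f - g) n :=
  fun z hz => sub_mem (hf z hz) (hg z hz)

lemma Kills.neg {f : C ⟶ D} {n : ℕ} (hf : Kills f n) : Kills (-f) n :=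
  fun z hz => neg_mem (hf z hz)

lemma exists_of_isIso_homologyMap (f : C ⟶ D) (n : ℕ)
    [IsIso (HomologicalComplex.homologyMap f n)] {z : D.X n} (hz : z ∈ D.cyc n) :
    ∃ y ∈ C.cyc n, f.f n y - z ∈ D.bdry n := by
  obtain ⟨x, hx⟩ := (ModuleCat.epi_iff_surjective (HomologicalComplex.homologyMap f n)).1
    inferInstance (D.cls n ⟨z, hz⟩)
  obtain ⟨y, rfl⟩ := C.cls_surjective n x
  refine ⟨y, y.2, ?_⟩
  rw [homologyMap_cls, ← sub_eq_zero, ← map_sub, cls_eq_zero_iff] at hx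
  exact hx

lemma mem_bdry_of_isIso_homologyMap (f : C ⟶ D) (n : ℕ)
    [IsIso (HomologicalComplex.homologyMap f n)] {z : C.X n} (hz : z ∈ C.cyc n)
    (h : f.f n z ∈ D.bdry n) : z ∈ C.bdry n := by
  rw [← cls_eq_zero_iff ⟨z, hz⟩]
  apply (ModuleCat.mono_iff_injective (HomologicalComplex.homologyMap f n)).1 inferInstance
  rw [homologyMap_cls, map_zero, cls_eq_zero_iff]
  exact h

end

section Field

variable {k : Type v} [Field k] {C D : ChainComplex (ModuleCat.{u} k) ℕ}

/-- Over a field, a map that vanishes on homology in a given degree is given by the formula of a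
homotopy in that degree. -/
lemma Kills.exists_eq {f : C ⟶ D} {n : ℕ} (h : Kills f n) :
    ∃ (w : C.X n →ₗ[k] D.X (n + 1)) (v : C.X (n - 1) →ₗ[k] D.X n),
      (f.f n).hom = (D.d (n + 1) n).hom ∘ₗ w + v ∘ₗ (C.d n (n - 1)).hom := by
  -- A section of `d` onto the boundaries lifts `f` on cycles; extend this lift to `w`. Then `f - d
  -- w` vanishes on cycles, so it factors through the image of `d`, and the factor extends to `v`.
  obtain ⟨s, hs⟩ := (D.d (n + 1) n).hom.rangeRestrict.exists_rightInverse_of_surjective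
    (LinearMap.range_rangeRestrict _)
  let w₀ : C.cyc n →ₗ[k] D.X (n + 1) :=
    s ∘ₗ ((f.f n).hom ∘ₗ (C.cyc n).subtype).codRestrict (D.bdry n) fun z => h z z.2
  obtain ⟨w, hw⟩ := LinearMap.exists_extend w₀
  have hker : LinearMap.ker (C.d n (n - 1)).hom ≤
      LinearMap.ker ((f.f n).hom - (D.d (n + 1) n).hom ∘ₗ w) := by
    intro z hz
    have h₁ : w z = w₀ ⟨z, hz⟩ := congr($hw ⟨z, hz⟩)
    have h₂ := congr(($hs ⟨f.f n z, h z hz⟩ : D.X n))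
    rw [LinearMap.mem_ker, LinearMap.sub_apply, LinearMap.comp_apply, h₁, sub_eq_zero]
    exact h₂.symm
  obtain ⟨v, hv⟩ := LinearMap.exists_extend
    ((LinearMap.ker (C.d n (n - 1)).hom).liftQ _ hker ∘ₗ
      (C.d n (n - 1)).hom.quotKerEquivRange.symm.toLinearMap)
  refine ⟨w, v, LinearMap.ext fun z => ?_⟩
  have h₁ := congr($hv ⟨C.d n (n - 1) z, z, rfl⟩)
  have h₂ : (C.d n (n - 1)).hom.quotKerEquivRange.symm ⟨C.d n (n - 1) z, z, rfl⟩ =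
      Submodule.Quotient.mk z := by
    rw [LinearEquiv.symm_apply_eq]
    rfl
  simp only [LinearMap.comp_apply, LinearEquiv.coe_coe, h₂, Submodule.liftQ_apply,
    Submodule.subtype_apply] at h₁
  rw [LinearMap.add_apply, LinearMap.comp_apply, LinearMap.comp_apply]
  erw [h₁]
  simp

end Field

end ChainComplex

/-! ### Levelwise tensor products of simplicial modules -/

namespace SimplicialModule

open Opposite TensorProduct ChainComplex

variable {k : Type v} [Field k]

/-- The chain complex of a simplicial module. -/
abbrev chains (A : SimplicialObject (ModuleCat.{u} k)) : ChainComplex (ModuleCat.{u} k) ℕ :=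
  (AlgebraicTopology.alternatingFaceMapComplex _).obj A

variable {A A' A'' B B' B'' : SimplicialObject (ModuleCat.{u} k)}

/-- The map of chain complexes induced by a map of simplicial modules. -/
abbrev chainsMap (f : A ⟶ B) : chains A ⟶ chains B :=
  (AlgebraicTopology.alternatingFaceMapComplex _).map f

/-- A map of simplicial modules that vanishes on homology in a given degree. -/
abbrev Kills (f : A ⟶ B) (n : ℕ) : Prop := ChainComplex.Kills (chainsMap f) n

lemma d_apply (n : ℕ) (z : A _⦋n + 1⦌) : (chains A).d (n + 1) n z =
    ∑ i : Fin (n + 2), (-1 : ℤ) ^ (i : ℕ) • A.δ i z := by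
  rw [AlgebraicTopology.alternatingFaceMapComplex_obj_d,
    AlgebraicTopology.AlternatingFaceMapComplex.objD]
  change ((ModuleCat.Hom.hom _ : _ →ₗ[k] _) : _ →ₗ[k] _) z = _
  rw [ModuleCat.hom_sum, LinearMap.sum_apply]
  rfl

lemma kills_of_homotopy {f g : A ⟶ B} (h : SimplicialObject.Homotopy f g) (n : ℕ) :
    Kills (f - g) n := by
  have := h.toChainHomotopy.kills_sub n
  rwa [← Functor.map_sub] at this

/-- The map of tensor products induced by two maps of modules. -/
def mtens {M M' N N' : ModuleCat.{u} k} (f : M ⟶ M') (g : N ⟶ N') :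
    ModuleCat.of k (M ⊗[k] N) ⟶ ModuleCat.of k (M' ⊗[k] N') :=
  ModuleCat.ofHom (TensorProduct.map f.hom g.hom)

lemma mtens_comp {M M' M'' N N' N'' : ModuleCat.{u} k} (f : M ⟶ M') (f' : M' ⟶ M'')
    (g : N ⟶ N') (g' : N' ⟶ N'') : mtens (f ≫ f') (g ≫ g') = mtens f g ≫ mtens f' g' :=
  ModuleCat.hom_ext (TensorProduct.map_comp _ _ _ _)

lemma mtens_id (M N : ModuleCat.{u} k) : mtens (𝟙 M) (𝟙 N) = 𝟙 _ :=
  ModuleCat.hom_ext TensorProduct.map_id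

/-- The levelwise tensor product of simplicial modules. -/
def tens (A B : SimplicialObject (ModuleCat.{u} k)) : SimplicialObject (ModuleCat.{u} k) where
  obj n := ModuleCat.of k (A.obj n ⊗[k] B.obj n)
  map f := mtens (A.map f) (B.map f)
  map_id n := by rw [A.map_id, B.map_id, mtens_id]
  map_comp f g := by rw [A.map_comp, B.map_comp, mtens_comp]

/-- The map of levelwise tensor products induced by two maps. -/
def tensMap (f : A ⟶ A') (g : B ⟶ B') : tens A B ⟶ tens A' B' where
  app n := mtens (f.app n) (g.app n)
  naturality _ _ φ := (mtens_comp _ _ _ _).symm.trans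
    (congr(mtens $(f.naturality φ) $(g.naturality φ)).trans (mtens_comp _ _ _ _))

lemma tensMap_comp (f : A ⟶ A') (f' : A' ⟶ A'') (g : B ⟶ B') (g' : B' ⟶ B'') :
    tensMap (f ≫ f') (g ≫ g') = tensMap f g ≫ tensMap f' g' :=
  NatTrans.ext (funext fun _ => mtens_comp _ _ _ _)

lemma tensMap_id (A B : SimplicialObject (ModuleCat.{u} k)) :
    tensMap (𝟙 A) (𝟙 B) = 𝟙 (tens A B) :=
  NatTrans.ext (funext fun _ => mtens_id _ _)

lemma tensMap_sub_right (f : A ⟶ A') (g g' : B ⟶ B') :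
    tensMap f (g - g') = tensMap f g - tensMap f g' :=
  NatTrans.ext (funext fun n => ModuleCat.hom_ext
    (TensorProduct.ext' fun x y => TensorProduct.tmul_sub (f.app n x) (g.app n y) (g'.app n y)))

/-- The tensor product of simplicial homotopies. -/
def tensHomotopy {f f' : A ⟶ A'} {g g' : B ⟶ B'} (h : SimplicialObject.Homotopy f f')
    (h' : SimplicialObject.Homotopy g g') :
    SimplicialObject.Homotopy (tensMap f g) (tensMap f' g') where
  h i := mtens (h.h i) (h'.h i)
  h_zero_comp_δ_zero n := (mtens_comp _ _ _ _).symm.trans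
    congr(mtens $(h.h_zero_comp_δ_zero n) $(h'.h_zero_comp_δ_zero n))
  h_last_comp_δ_last n := (mtens_comp _ _ _ _).symm.trans
    congr(mtens $(h.h_last_comp_δ_last n) $(h'.h_last_comp_δ_last n))
  h_succ_comp_δ_castSucc_of_lt i j hij := (mtens_comp _ _ _ _).symm.trans
    (congr(mtens $(h.h_succ_comp_δ_castSucc_of_lt i j hij) $(h'.h_succ_comp_δ_castSucc_of_lt i j hij)).trans
      (mtens_comp _ _ _ _))
  h_succ_comp_δ_castSucc_succ j := (mtens_comp _ _ _ _).symm.trans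
    (congr(mtens $(h.h_succ_comp_δ_castSucc_succ j) $(h'.h_succ_comp_δ_castSucc_succ j)).trans
      (mtens_comp _ _ _ _))
  h_castSucc_comp_δ_succ_of_lt i j hij := (mtens_comp _ _ _ _).symm.trans
    (congr(mtens $(h.h_castSucc_comp_δ_succ_of_lt i j hij) $(h'.h_castSucc_comp_δ_succ_of_lt i j hij)).trans
      (mtens_comp _ _ _ _))
  h_comp_σ_castSucc_of_le i j hij := (mtens_comp _ _ _ _).symm.trans
    (congr(mtens $(h.h_comp_σ_castSucc_of_le i j hij) $(h'.h_comp_σ_castSucc_of_le i j hij)).trans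
      (mtens_comp _ _ _ _))
  h_comp_σ_succ_of_lt i j hij := (mtens_comp _ _ _ _).symm.trans
    (congr(mtens $(h.h_comp_σ_succ_of_lt i j hij) $(h'.h_comp_σ_succ_of_lt i j hij)).trans
      (mtens_comp _ _ _ _))

/-- The formula `f = D w + v d` survives tensoring with `V`, and its second term dies on cycles.
This spares a description of the cycles of a tensor product. -/
lemma map_id_eq_of_eq_add {M₀ M M' M₁ V : Type*} [AddCommGroup M₀] [AddCommGroup M]
    [AddCommGroup M'] [AddCommGroup M₁] [AddCommGroup V] [Module k M₀] [Module k M] [Module k M']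
    [Module k M₁] [Module k V] {f : M →ₗ[k] M'} {w : M →ₗ[k] M₁} {D : M₁ →ₗ[k] M'}
    {d : M →ₗ[k] M₀} {v : M₀ →ₗ[k] M'} (h : f = D ∘ₗ w + v ∘ₗ d) {z : M ⊗[k] V}
    (hz : TensorProduct.map d (LinearMap.id : V →ₗ[k] V) z = 0) :
    TensorProduct.map D (LinearMap.id : V →ₗ[k] V) (TensorProduct.map w LinearMap.id z) =
      TensorProduct.map f (LinearMap.id : V →ₗ[k] V) z := by
  rw [h, TensorProduct.map_add_left, LinearMap.add_apply, ← LinearMap.comp_apply,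
    ← TensorProduct.map_comp, LinearMap.comp_id, left_eq_add,
    ← LinearMap.comp_id (LinearMap.id : V →ₗ[k] V), TensorProduct.map_comp, LinearMap.comp_apply,
    hz, map_zero]

lemma map_sum_zsmul_id {ι M M' V : Type*} [Fintype ι] [AddCommGroup M] [AddCommGroup M']
    [AddCommGroup V] [Module k M] [Module k M'] [Module k V] (c : ι → ℤ) (f : ι → M →ₗ[k] M') :
    TensorProduct.map (∑ i, c i • f i) (LinearMap.id : V →ₗ[k] V) =
      ∑ i, c i • TensorProduct.map (f i) (LinearMap.id : V →ₗ[k] V) :=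
  TensorProduct.ext' fun x y => by
    simp [LinearMap.sum_apply, TensorProduct.sum_tmul, TensorProduct.smul_tmul']

lemma kills_tensMap_sub {g g' : B ⟶ B'} (f : A ⟶ A') (h : SimplicialObject.Homotopy g g')
    (n : ℕ) : Kills (tensMap f g - tensMap f g') n :=
  kills_of_homotopy (tensHomotopy (SimplicialObject.Homotopy.refl f) h) n

/-- A map that vanishes on homology still does so after tensoring with a constant module. -/
lemma Kills.tensMap_const {f : A ⟶ A'} {n : ℕ} (h : Kills f n) (V : ModuleCat.{u} k) :
    Kills (tensMap f (𝟙 ((SimplicialObject.const _).obj V))) n := by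
  have hd (A : SimplicialObject (ModuleCat.{u} k)) (m : ℕ) :
      ((chains (tens A ((SimplicialObject.const _).obj V))).d (m + 1) m).hom =
        TensorProduct.map ((chains A).d (m + 1) m).hom (LinearMap.id : V →ₗ[k] V) := by
    refine LinearMap.ext fun z => ?_
    refine (d_apply (A := tens A ((SimplicialObject.const _).obj V)) m z).trans ?_
    have : ((chains A).d (m + 1) m).hom =
        ∑ i : Fin (m + 2), (-1 : ℤ) ^ (i : ℕ) • (A.δ i).hom :=
      LinearMap.ext fun z => by
        rw [LinearMap.sum_apply]
        exact d_apply m z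
    rw [this]
    exact (LinearMap.sum_apply _ _ _).symm.trans
      congr($((map_sum_zsmul_id (V := V) (fun i : Fin (m + 2) => (-1 : ℤ) ^ (i : ℕ))
        fun i : Fin (m + 2) => (A.δ i).hom).symm) z)
  obtain ⟨w, v, hwv⟩ := ChainComplex.Kills.exists_eq h
  intro z hz
  refine ⟨TensorProduct.map w LinearMap.id z, ?_⟩
  rw [hd]
  refine map_id_eq_of_eq_add hwv ?_
  cases n with
  | zero =>
    rw [(chains A).shape _ _ (by simp), ModuleCat.hom_zero, TensorProduct.map_zero_left]
    rfl
  | succ n => exact congr($(hd A n) z).symm.trans hz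

end SimplicialModule

/-! ### Vanishing on tensor products by dimension shifting -/

namespace SimplicialModule

open Opposite TensorProduct ChainComplex

variable {k : Type v} [Field k] {A A' B B' : SimplicialObject (ModuleCat.{u} k)}

/-- The levelwise kernel of a map of simplicial modules. -/
def ker (f : A ⟶ B) : SimplicialObject (ModuleCat.{u} k) where
  obj n := ModuleCat.of k (LinearMap.ker (f.app n).hom)
  map {m n} φ := ModuleCat.ofHom ((A.map φ).hom.restrict fun x hx => by
    have : f.app n (A.map φ x) = B.map φ (f.app m x) := congr($(f.naturality φ) x)
    rw [LinearMap.mem_ker] at hx ⊢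
    exact this.trans ((congrArg _ hx).trans (map_zero _)))
  map_id n := by
    ext x : 3
    exact congr($(A.map_id n) x)
  map_comp φ ψ := by
    ext x : 3
    exact congr($(A.map_comp φ ψ) x)

/-- The inclusion of the levelwise kernel. -/
def kerι (f : A ⟶ B) : ker f ⟶ A where
  app n := ModuleCat.ofHom (LinearMap.ker (f.app n).hom).subtype

/-- Levelwise, the tensor product with the kernel of a split surjection is again the kernel. -/
lemma exists_of_split {f : A ⟶ B} {n : SimplexCategoryᵒᵖ} {s : B.obj n ⟶ A.obj n}
    (hs : s ≫ f.app n = 𝟙 _) (A' : SimplicialObject (ModuleCat.{u} k)) :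
    ∃ r : (tens A' A).obj n ⟶ (tens A' (ker f)).obj n,
      (tensMap (𝟙 A') (kerι f)).app n ≫ r = 𝟙 _ ∧
      ∀ x, (tensMap (𝟙 A') f).app n x = 0 → (tensMap (𝟙 A') (kerι f)).app n (r x) = x := by
  let r₀ : A.obj n ⟶ (ker f).obj n := ModuleCat.ofHom
    ((𝟙 (A.obj n) - f.app n ≫ s).hom.codRestrict _ fun x => by
      have : f.app n (s (f.app n x)) = f.app n x := congr($hs (f.app n x))
      change f.app n (x - s (f.app n x)) = 0
      rw [map_sub, this, sub_self])
  have h₁ : (kerι f).app n ≫ r₀ = 𝟙 _ := by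
    have key (x : LinearMap.ker (f.app n).hom) : (x : A.obj n) - s (f.app n x) = x := by
      rw [show f.app n x = 0 from x.2, map_zero, sub_zero]
    ext x : 3
    exact Subtype.ext (key x)
  have h₂ : r₀ ≫ (kerι f).app n = 𝟙 (A.obj n) - f.app n ≫ s := rfl
  refine ⟨mtens (𝟙 _) r₀, ?_, fun x hx => ?_⟩
  · refine (mtens_comp _ _ _ _).symm.trans ?_
    rw [h₁]
    exact mtens_id _ _
  · change (mtens (𝟙 (A'.obj n)) r₀ ≫ mtens (𝟙 (A'.obj n)) ((kerι f).app n)) x = x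
    rw [← mtens_comp, h₂]
    have h₃ : mtens (𝟙 (A'.obj n) ≫ 𝟙 (A'.obj n)) (𝟙 (A.obj n) - f.app n ≫ s) =
        𝟙 _ - mtens (𝟙 (A'.obj n)) (f.app n) ≫ mtens (𝟙 (A'.obj n)) s := by
      rw [← mtens_comp]
      exact ModuleCat.hom_ext (TensorProduct.ext' fun x y => TensorProduct.tmul_sub _ _ _)
    have key (y : ModuleCat.of k (A'.obj n ⊗[k] A.obj n))
        (hy : mtens (𝟙 (A'.obj n)) (f.app n) y = 0) :
        y - mtens (𝟙 (A'.obj n)) s (mtens (𝟙 (A'.obj n)) (f.app n) y) = y := by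
      rw [hy, map_zero, sub_zero]
    rw [h₃]
    exact key x hx

lemma tensMap_id_right_comm (f : A ⟶ A') (g : B ⟶ B') :
    tensMap f (𝟙 B) ≫ tensMap (𝟙 A') g = tensMap (𝟙 A) g ≫ tensMap f (𝟙 B') := by
  rw [← tensMap_comp, ← tensMap_comp]
  simp

lemma exists_section_decε (B : SimplicialObject (ModuleCat.{u} k)) (n : ℕ) :
    ∃ s : B _⦋n⦌ ⟶ B.dec _⦋n⦌, s ≫ B.decε.app (op ⦋n⦌) = 𝟙 _ :=
  ⟨B.σ 0, B.δ_comp_σ_self (i := 0)⟩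

lemma chainsMap_comp (f : A ⟶ B) (g : B ⟶ B') : chainsMap (f ≫ g) = chainsMap f ≫ chainsMap g :=
  Functor.map_comp _ _ _

lemma chainsMap_sub (f g : A ⟶ B) : chainsMap (f - g) = chainsMap f - chainsMap g :=
  Functor.map_sub _

/-- Tensoring a map that vanishes on homology with a décalage. -/
lemma Kills.tensMap_dec {f : A ⟶ A'} {n : ℕ} (h : Kills f n)
    (B : SimplicialObject (ModuleCat.{u} k)) : Kills (tensMap f (𝟙 B.dec)) n := by
  -- Up to homotopy the identity of the décalage factors through a constant module, where
  -- `Kills.tensMap_const` applies.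
  have h₁ := kills_tensMap_sub f (SimplicialObject.decHomotopy (X := B)) n
  have h₂ : Kills (tensMap f (SimplicialObject.decRetract (X := B))) n := by
    have : tensMap f (SimplicialObject.decRetract (X := B)) =
        tensMap (𝟙 A) B.decAug.hom ≫ tensMap f (𝟙 _) ≫
          tensMap (𝟙 A') B.decExtraDegeneracy.section_ := by
      rw [← tensMap_comp, ← tensMap_comp, Category.id_comp, Category.id_comp, Category.comp_id]
      rfl
    rw [this, Kills, chainsMap_comp, chainsMap_comp]
    exact ((h.tensMap_const _).comp_left _).comp_right _
  have := h₂.sub h₁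
  rwa [chainsMap_sub, sub_sub_cancel] at this

/-- The lifting of cycles to the décalage. -/
lemma exists_lift_dec {f : A ⟶ A'} {B : SimplicialObject (ModuleCat.{u} k)} {j : ℕ}
    (h : ∀ i, i + 1 = j → Kills (tensMap f (𝟙 (ker B.decε))) i)
    {z : (chains (tens A B)).X j} (hz : z ∈ (chains (tens A B)).cyc j) :
    ∃ y ∈ (chains (tens A' B.dec)).cyc j,
      (chainsMap (tensMap (𝟙 A') B.decε)).f j y = (chainsMap (tensMap f (𝟙 B))).f j z := by
  obtain ⟨s, hs⟩ := exists_section_decε B j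
  -- A levelwise lift of `z` need not be a cycle, but its boundary maps to zero in `A ⊗ B` and so
  -- comes from the tensor product with the kernel. This boundary `x` is the obstruction.
  obtain ⟨y₀, hy₀⟩ : ∃ y₀ : (chains (tens A B.dec)).X j,
      (chainsMap (tensMap (𝟙 A) B.decε)).f j y₀ = z := by
    refine ⟨mtens (𝟙 _) s z, ?_⟩
    have : mtens (𝟙 (A _⦋j⦌)) s ≫ mtens (𝟙 (A _⦋j⦌)) (B.decε.app (op ⦋j⦌)) = 𝟙 _ := by
      rw [← mtens_comp, hs, Category.id_comp, mtens_id]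
    exact congr($this z)
  have hcomm (i : ℕ) (x : (chains (tens A B.dec)).X i) :
      (chainsMap (tensMap (𝟙 A') B.decε)).f i ((chainsMap (tensMap f (𝟙 B.dec))).f i x) =
      (chainsMap (tensMap f (𝟙 B))).f i ((chainsMap (tensMap (𝟙 A) B.decε)).f i x) :=
    congr(($(tensMap_id_right_comm f B.decε)).app (op ⦋i⦌) x)
  cases j with
  | zero => exact ⟨(chainsMap (tensMap f (𝟙 B.dec))).f 0 y₀, mem_cyc_zero _, by rw [hcomm, hy₀]⟩
  | succ i =>
    obtain ⟨s', hs'⟩ := exists_section_decε B i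
    obtain ⟨r, hr, hr'⟩ := exists_of_split hs' A
    have hx : (chainsMap (tensMap (𝟙 A) B.decε)).f i ((chains (tens A B.dec)).d (i + 1) i y₀) = 0 := by
      rw [← d_f_apply, hy₀]
      exact hz
    have hx' := hr' _ hx
    set x : (chains (tens A (ker B.decε))).X i := r ((chains (tens A B.dec)).d (i + 1) i y₀)
    have hx' : (chainsMap (tensMap (𝟙 A) (kerι B.decε))).f i x =
        (chains (tens A B.dec)).d (i + 1) i y₀ := hx'
    have hxc : x ∈ (chains (tens A (ker B.decε))).cyc i := by
      cases i with
      | zero => exact mem_cyc_zero _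
      | succ l =>
        -- The inclusion of the tensor product with the kernel has a levelwise retraction, so `x`
        -- may be tested for being a cycle in the décalage, where it is a boundary.
        obtain ⟨s'', hs''⟩ := exists_section_decε B l
        obtain ⟨r', hr₁, -⟩ := exists_of_split hs'' A
        rw [mem_cyc]
        have : (chainsMap (tensMap (𝟙 A) (kerι B.decε))).f l
            ((chains (tens A (ker B.decε))).d (l + 1) l x) = 0 := by
          rw [← d_f_apply, hx']
          exact congr($((chains (tens A B.dec)).d_comp_d (l + 1 + 1) (l + 1) l) y₀)
        refine (congr($hr₁ ((chains (tens A (ker B.decε))).d (l + 1) l x))).symm.trans ?_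
        exact (congrArg r' this).trans (map_zero r'.hom)
    -- Applying `f` turns the obstruction into the boundary of `w`. Subtracting `w` from the image
    -- of `y₀` gives a cycle, and `w` is invisible in `B`.
    obtain ⟨w, hw⟩ := h i rfl x hxc
    refine ⟨(chainsMap (tensMap f (𝟙 B.dec))).f (i + 1) y₀ -
      (chainsMap (tensMap (𝟙 A') (kerι B.decε))).f (i + 1) w, ?_, ?_⟩
    · have h₁ : (chains (tens A' B.dec)).d (i + 1) i
          ((chainsMap (tensMap f (𝟙 B.dec))).f (i + 1) y₀) =
          (chainsMap (tensMap f (𝟙 B.dec))).f i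
            ((chainsMap (tensMap (𝟙 A) (kerι B.decε))).f i x) := by
        rw [hx', d_f_apply]
      have h₂ : (chains (tens A' B.dec)).d (i + 1) i
          ((chainsMap (tensMap (𝟙 A') (kerι B.decε))).f (i + 1) w) =
          (chainsMap (tensMap (𝟙 A') (kerι B.decε))).f i
            ((chainsMap (tensMap f (𝟙 (ker B.decε)))).f i x) := by
        rw [d_f_apply]
        exact congrArg _ hw
      have h₃ : (chainsMap (tensMap f (𝟙 B.dec))).f i
            ((chainsMap (tensMap (𝟙 A) (kerι B.decε))).f i x) =
          (chainsMap (tensMap (𝟙 A') (kerι B.decε))).f i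
            ((chainsMap (tensMap f (𝟙 (ker B.decε)))).f i x) :=
        congr(($(tensMap_id_right_comm f (kerι B.decε))).app (op ⦋i⦌) x).symm
      change (chains (tens A' B.dec)).d (i + 1) i _ = 0
      rw [map_sub, h₁, h₂, h₃, sub_self]
    · have h₀ : kerι B.decε ≫ B.decε = 0 := by
        ext n x : 4
        exact x.2
      have h₁ : (chainsMap (tensMap (𝟙 A') B.decε)).f (i + 1)
          ((chainsMap (tensMap (𝟙 A') (kerι B.decε))).f (i + 1) w) = 0 := by
        have : tensMap (𝟙 A') (kerι B.decε) ≫ tensMap (𝟙 A') B.decε = 0 := by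
          rw [← tensMap_comp, h₀]
          exact NatTrans.ext (funext fun n => ModuleCat.hom_ext
            (TensorProduct.ext' fun x y => TensorProduct.tmul_zero _ _))
        exact congr(($this).app (op ⦋i + 1⦌) w)
      rw [map_sub, h₁, hcomm, hy₀, sub_zero]

/-- If `f` vanishes on homology below degree `n`, then a power of `f`, tensored with any simplicial
module, vanishes on homology in a given degree below `n`. -/
lemma kills_tensMap_pow {f : End A} {n : ℕ} (hf : ∀ i < n, Kills (f : A ⟶ A) i) {j : ℕ}
    (hj : j < n) (B : SimplicialObject (ModuleCat.{u} k)) :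
    Kills (tensMap (f ^ (j + 1) : End A) (𝟙 B)) j := by
  induction j generalizing B with
  | zero =>
    intro z hz
    rw [zero_add, pow_one]
    -- In degree `0` nothing obstructs the lift, so the only factor `f` is kept for the décalage.
    obtain ⟨y, hy, hyz⟩ := exists_lift_dec (f := 𝟙 A) (by simp) hz
    have : z = (chainsMap (tensMap (𝟙 A) B.decε)).f 0 y := by
      rw [hyz, tensMap_id]
      rfl
    have hcomm := congr(($(tensMap_id_right_comm f B.decε)).app (op ⦋0⦌) y)
    rw [this]
    change (tensMap (𝟙 A) B.decε ≫ tensMap f (𝟙 B)).app (op ⦋0⦌) y ∈ _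
    rw [← hcomm]
    exact map_mem_bdry (chainsMap (tensMap (𝟙 A) B.decε)) ((hf 0 hj).tensMap_dec B y hy)
  | succ j ih =>
    intro z hz
    -- By induction over the kernel, `j + 1` factors of `f` lift the cycle to the décalage; the last
    -- factor makes the lift a boundary.
    obtain ⟨y, hy, hyz⟩ := exists_lift_dec (f := (f ^ (j + 1) : End A)) (by
      intro i hi
      obtain rfl : i = j := by omega
      exact ih (by omega) _) hz
    have hcomm := congr(($(tensMap_id_right_comm f B.decε)).app (op ⦋j + 1⦌) y)
    have h₁ : tensMap (f ^ (j + 1 + 1) : End A) (𝟙 B) =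
        tensMap (f ^ (j + 1) : End A) (𝟙 B) ≫ tensMap f (𝟙 B) := by
      rw [← tensMap_comp, pow_succ', Category.id_comp]
      rfl
    rw [h₁]
    change (tensMap f (𝟙 B)).app (op ⦋j + 1⦌) ((tensMap (f ^ (j + 1) : End A) (𝟙 B)).app _ z) ∈ _
    erw [← hyz]
    change (tensMap (𝟙 A) B.decε ≫ tensMap f (𝟙 B)).app (op ⦋j + 1⦌) y ∈ _
    rw [← hcomm]
    exact map_mem_bdry (chainsMap (tensMap (𝟙 A) B.decε)) ((hf (j + 1) hj).tensMap_dec B y hy)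

/-- If `f` vanishes on homology below degree `n` and `g` vanishes on homology in degree `0`, then
the tensor product of a power of `f` with `g` vanishes on homology in degree `n`. -/
lemma kills_tensMap_pow_of_kills_zero {f : End A} {n : ℕ}
    (hf : ∀ i < n, Kills (f : A ⟶ A) i) {g : B ⟶ B'} (hg : Kills g 0) :
    Kills (tensMap (f ^ n : End A) g) n := by
  intro z hz
  -- All `n` factors of `f` go into the lift, whose obstruction lies in degree `n - 1`. In degree
  -- `n` itself `f` says nothing, and `g` has to do the work.
  obtain ⟨y, hy, hyz⟩ := exists_lift_dec (f := (f ^ n : End A)) (by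
      intro i hi
      obtain rfl := hi
      exact kills_tensMap_pow hf (Nat.lt_succ_self i) _) hz
  have h₁ : tensMap (f ^ n : End A) g = tensMap (f ^ n : End A) (𝟙 B) ≫ tensMap (𝟙 A) g := by
    rw [← tensMap_comp, Category.id_comp, Category.comp_id]
  rw [h₁]
  change (tensMap (𝟙 A) g).app (op ⦋n⦌) ((tensMap (f ^ n : End A) (𝟙 B)).app _ z) ∈ _
  erw [← hyz]
  change (tensMap (𝟙 A) B.decε ≫ tensMap (𝟙 A) g).app (op ⦋n⦌) y ∈ _
  rw [← tensMap_comp, Category.id_comp]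
  refine (?_ : Kills (tensMap (𝟙 A) (B.decε ≫ g)) n) y hy
  -- Vanishing in degree `0` writes `g` on vertices as the difference of the two ends of a linear
  -- family of edges `c`.
  obtain ⟨c, v, hc⟩ := ChainComplex.Kills.exists_eq hg
  rw [(chains B).shape _ _ (by simp), ModuleCat.hom_zero, LinearMap.comp_zero, add_zero] at hc
  let c' : B _⦋0⦌ ⟶ B' _⦋1⦌ := ModuleCat.ofHom c
  have hc' : g.app (op ⦋0⦌) = c' ≫ B'.δ 0 - c' ≫ B'.δ 1 := by
    ext x : 2
    have h₁ : g.app (op ⦋0⦌) x = (chains B').d 1 0 (c x) := congr($hc x)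
    rw [d_apply, Fin.sum_univ_two] at h₁
    simp only [Fin.val_zero, pow_zero, one_smul, Fin.val_one, pow_one, neg_smul] at h₁
    exact h₁.trans (sub_eq_add_neg _ _).symm
  -- On the contracted décalage only `g` in degree `0` matters, and the constant maps given by the
  -- two ends of `c` are homotopic.
  have hε : SimplicialObject.decRetract (X := B) ≫ B.decε ≫ g =
      B.decAug.hom ≫ (SimplicialObject.constHom (c' ≫ B'.δ 0) -
        SimplicialObject.constHom (c' ≫ B'.δ 1)) := by
    rw [← Category.assoc, SimplicialObject.decRetract_comp_decε, Category.assoc]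
    congr 1
    refine SimplicialObject.const_hom_ext ?_
    rw [NatTrans.comp_app, SimplicialObject.constHom_app_zero, NatTrans.app_sub,
      SimplicialObject.constHom_app_zero, SimplicialObject.constHom_app_zero, hc']
    exact Category.id_comp _
  have h₂ : Kills (tensMap (𝟙 A) (SimplicialObject.constHom (c' ≫ B'.δ 0) -
        SimplicialObject.constHom (c' ≫ B'.δ 1))) n := by
    have := (kills_tensMap_sub (𝟙 A) (SimplicialObject.constHomHomotopy c') n).neg
    rwa [chainsMap_sub, neg_sub, ← chainsMap_sub, ← tensMap_sub_right] at this
  have h₃ := (kills_tensMap_sub (𝟙 A)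
    ((SimplicialObject.decHomotopy (X := B)).postcomp (B.decε ≫ g)) n)
  rw [hε, ← Category.id_comp (𝟙 A), tensMap_comp, Category.id_comp, Category.id_comp] at h₃
  have h₄ := (h₂.comp_right (chainsMap (tensMap (𝟙 A) B.decAug.hom))).sub h₃
  rwa [chainsMap_sub, ← chainsMap_comp, sub_sub_cancel] at h₄

end SimplicialModule

/-! ### External products of finitely supported functions -/

namespace Finsupp

open TensorProduct

variable {k : Type*} [Field k] {ι : Type*} [Fintype ι] {S T : Type*}

/-- The external product of finitely supported functions. -/
def extProd (k : Type*) [Field k] (ι : Type*) [Fintype ι] (S : Type*) :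
    MultilinearMap k (fun _ : ι => S →₀ k) ((ι → S) →₀ k) := by
  classical
  exact MultilinearMap.mk'
    (fun a => Finsupp.onFinset (Fintype.piFinset fun i => (a i).support)
      (fun x => ∏ i, a i (x i)) fun x hx => by
        simp only [Fintype.mem_piFinset, mem_support_iff]
        intro i h
        exact hx (Finset.prod_eq_zero (Finset.mem_univ i) h))
    (fun a i b c => by
      ext x
      exact ((MultilinearMap.mkPiAlgebra k ι k).compLinearMap
        fun i => Finsupp.lapply (x i)).map_update_add a i b c)
    (fun a i r b => by
      ext x
      exact ((MultilinearMap.mkPiAlgebra k ι k).compLinearMap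
        fun i => Finsupp.lapply (x i)).map_update_smul a i r b)

lemma extProd_apply (a : ι → S →₀ k) (x : ι → S) : extProd k ι S a x = ∏ i, a i (x i) := rfl

lemma extProd_single (x : ι → S) :
    extProd k ι S (fun i => single (x i) 1) = single x 1 := by
  classical
  ext y
  rw [extProd_apply]
  by_cases h : x = y
  · subst h
    simp
  · obtain ⟨i, hi⟩ := Function.ne_iff.1 h
    rw [single_eq_of_ne' h]
    exact Finset.prod_eq_zero (Finset.mem_univ i) (single_eq_of_ne' hi)

lemma extProd_mapDomain (f : S → T) (a : ι → S →₀ k) :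
    extProd k ι T (fun i => mapDomain f (a i)) =
      mapDomain (fun x i => f (x i)) (extProd k ι S a) := by
  have : (extProd k ι T).compLinearMap (fun _ => Finsupp.lmapDomain k k f) =
      (Finsupp.lmapDomain k k fun (x : ι → S) i => f (x i)).compMultilinearMap (extProd k ι S) := by
    refine Module.Basis.ext_multilinear (fun _ => Finsupp.basisSingleOne) fun x => ?_
    simp [extProd_single]
  exact congr($this a)

lemma extProd_comp_perm (σ : Equiv.Perm ι) (a : ι → S →₀ k) :
    extProd k ι S (a ∘ σ) = mapDomain (fun x i => x (σ i)) (extProd k ι S a) := by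
  have := Finsupp.equivMapDomain_eq_mapDomain (σ.arrowCongr (Equiv.refl S)).symm
    (extProd k ι S a)
  refine Eq.trans ?_ this
  ext x
  rw [Finsupp.equivMapDomain_apply, extProd_apply, extProd_apply]
  refine Fintype.prod_equiv σ _ _ fun i => ?_
  simp [Equiv.arrowCongr]

/-- The external product with one further factor. -/
def tensorCons (k : Type*) [Field k] (q : ℕ) (S : Type*) :
    (S →₀ k) ⊗[k] ((Fin q → S) →₀ k) →ₗ[k] ((Fin (q + 1) → S) →₀ k) :=
  Finsupp.lmapDomain k k (fun x : S × (Fin q → S) => (Fin.cons x.1 x.2 : Fin (q + 1) → S)) ∘ₗ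
    (finsuppTensorFinsupp' k S (Fin q → S)).toLinearMap

lemma tensorCons_single {q : ℕ} (s : S) (x : Fin q → S) :
    tensorCons k q S (single s 1 ⊗ₜ single x 1) = single (Fin.cons s x : Fin (q + 1) → S) 1 := by
  simp [tensorCons]

lemma tensorCons_extProd {q : ℕ} (a : S →₀ k) (b : Fin q → S →₀ k) :
    tensorCons k q S (a ⊗ₜ extProd k (Fin q) S b) =
      extProd k (Fin (q + 1)) S (Fin.cons a b) := by
  have := Finsupp.equivMapDomain_eq_mapDomain (Fin.consEquiv fun _ : Fin (q + 1) => S)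
    (finsuppTensorFinsupp' k S (Fin q → S) (a ⊗ₜ extProd k (Fin q) S b))
  refine this.symm.trans ?_
  ext x
  rw [Finsupp.equivMapDomain_apply, extProd_apply, Fin.prod_univ_succ]
  exact finsuppTensorFinsupp'_apply_apply k S (Fin q → S) a (extProd k (Fin q) S b) (x 0) (Fin.tail x)

end Finsupp

/-! ### Free simplicial modules, external powers and the diagonal -/

namespace SimplicialModule

open Opposite TensorProduct ChainComplex

variable {k : Type} [Field k]

/-- The free module functor. -/
@[simps]
def freeModule (k : Type) [Field k] : Type u ⥤ ModuleCat.{u} k where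
  obj S := ModuleCat.of k (S →₀ k)
  map f := ModuleCat.ofHom (Finsupp.lmapDomain k k f)
  map_id _ := ModuleCat.hom_ext (Finsupp.lmapDomain_id k k)
  map_comp f g := ModuleCat.hom_ext (Finsupp.lmapDomain_comp k k f g)

/-- The free simplicial module on a simplicial set. -/
abbrev linFunctor (k : Type) [Field k] : SSet.{u} ⥤ SimplicialObject (ModuleCat.{u} k) :=
  (SimplicialObject.whiskering _ _).obj (freeModule k)

/-- The free simplicial module on a simplicial set. -/
abbrev lin (k : Type) [Field k] (X : SSet.{u}) : SimplicialObject (ModuleCat.{u} k) :=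
  (linFunctor k).obj X

variable (k) in
/-- The map of free simplicial modules induced by a map of simplicial sets. -/
abbrev linMap {X Y : SSet.{u}} (f : X ⟶ Y) : lin k X ⟶ lin k Y := (linFunctor k).map f

variable {X Y Z : SSet.{u}} {A : SimplicialObject (ModuleCat.{u} k)}

/-- The basis element of the free simplicial module given by a simplex. -/
def basisElt (k : Type) [Field k] {X : SSet.{u}} {n : SimplexCategoryᵒᵖ} (x : X.obj n) :
    (lin k X).obj n :=
  (Finsupp.single x 1 : X.obj n →₀ k)

lemma lin_map_basisElt {m n : SimplexCategoryᵒᵖ} (φ : m ⟶ n) (x : X.obj m) :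
    (lin k X).map φ (basisElt k x) = basisElt k (X.map φ x) :=
  Finsupp.mapDomain_single

lemma linMap_basisElt (f : X ⟶ Y) {n : SimplexCategoryᵒᵖ} (x : X.obj n) :
    (linMap k f).app n (basisElt k x) = basisElt k (f.app n x) :=
  Finsupp.mapDomain_single

lemma lin_hom_ext {f g : lin k X ⟶ A}
    (h : ∀ (n : SimplexCategoryᵒᵖ) (x : X.obj n),
      f.app n (basisElt k x) = g.app n (basisElt k x)) : f = g := by
  refine NatTrans.ext (funext fun n => ModuleCat.hom_ext (Finsupp.lhom_ext' fun x => ?_))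
  exact LinearMap.ext_ring (h n x)

/-- The map from a free simplicial module given by a natural family of elements. -/
def linDesc (F : ∀ n : SimplexCategoryᵒᵖ, X.obj n → A.obj n)
    (hF : ∀ {m n : SimplexCategoryᵒᵖ} (φ : m ⟶ n) (x : X.obj m),
      A.map φ (F m x) = F n (X.map φ x)) : lin k X ⟶ A where
  app n := ModuleCat.ofHom (Finsupp.linearCombination k (F n))
  naturality m n φ := by
    refine ModuleCat.hom_ext (Finsupp.lhom_ext' fun x => LinearMap.ext_ring ?_)
    have h₁ : Finsupp.linearCombination k (F n) (Finsupp.mapDomain (X.map φ)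
        (Finsupp.single x 1)) = F n (X.map φ x) := by
      rw [Finsupp.mapDomain_single, Finsupp.linearCombination_single, one_smul]
    have h₂ : A.map φ (Finsupp.linearCombination k (F m) (Finsupp.single x 1)) =
        A.map φ (F m x) := by
      rw [Finsupp.linearCombination_single, one_smul]
    exact h₁.trans ((hF φ x).symm.trans h₂.symm)

lemma linDesc_basisElt (F : ∀ n : SimplexCategoryᵒᵖ, X.obj n → A.obj n)
    (hF : ∀ {m n : SimplexCategoryᵒᵖ} (φ : m ⟶ n) (x : X.obj m),
      A.map φ (F m x) = F n (X.map φ x)) {n : SimplexCategoryᵒᵖ} (x : X.obj n) :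
    (linDesc F hF).app n (basisElt k x) = F n x := by
  have h₁ : Finsupp.linearCombination k (F n) (Finsupp.single x 1) = F n x := by
    rw [Finsupp.linearCombination_single, one_smul]
  exact h₁

variable {ι : Type} [Fintype ι]

/-- The external product of a family of elements of a free simplicial module. -/
def extElt {n : SimplexCategoryᵒᵖ} (a : ι → (lin k Y).obj n) : (lin k (Y.pow ι)).obj n :=
  Finsupp.extProd k ι (Y.obj n) a

lemma lin_map_extElt {m n : SimplexCategoryᵒᵖ} (φ : m ⟶ n) (a : ι → (lin k Y).obj m) :
    (lin k (Y.pow ι)).map φ (extElt a) = extElt fun i => (lin k Y).map φ (a i) :=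
  (Finsupp.extProd_mapDomain (Y.map φ) a).symm

lemma extElt_basisElt {n : SimplexCategoryᵒᵖ} (x : ι → Y.obj n) :
    extElt (fun i => basisElt k (x i)) = basisElt (X := Y.pow ι) k x :=
  Finsupp.extProd_single x

lemma extElt_comp_perm {n : SimplexCategoryᵒᵖ} (a : ι → (lin k Y).obj n) (σ : Equiv.Perm ι) :
    extElt (a ∘ σ) = (linMap k (Y.powReindex σ)).app n (extElt a) :=
  Finsupp.extProd_comp_perm σ a

lemma lin_map_extElt_app (a : ι → (lin k X ⟶ lin k Y)) {m n : SimplexCategoryᵒᵖ} (φ : m ⟶ n)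
    (x : X.obj m) : (lin k (Y.pow ι)).map φ (extElt fun i => (a i).app m (basisElt k x)) =
      extElt fun i => (a i).app n (basisElt k (X.map φ x)) := by
    rw [lin_map_extElt]
    congr 1
    funext i
    rw [← lin_map_basisElt]
    exact congr($((a i).naturality φ) (basisElt k x)).symm

/-- The pairing of a family of maps between free simplicial modules, analogous to
`SSet.powLift`. -/
def linLift (a : ι → (lin k X ⟶ lin k Y)) : lin k X ⟶ lin k (Y.pow ι) :=
  linDesc (fun n x => extElt fun i => (a i).app n (basisElt k x)) (lin_map_extElt_app a)

lemma linLift_basisElt (a : ι → (lin k X ⟶ lin k Y)) {n : SimplexCategoryᵒᵖ} (x : X.obj n) :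
    (linLift a).app n (basisElt k x) = extElt fun i => (a i).app n (basisElt k x) :=
  linDesc_basisElt _ (lin_map_extElt_app a) x

lemma linLift_linMap (f : ι → (X ⟶ Y)) :
    linLift (fun i => linMap k (f i)) = linMap k (SSet.powLift f) :=
  lin_hom_ext fun n x => by
    rw [linLift_basisElt, linMap_basisElt]
    simp only [linMap_basisElt]
    exact extElt_basisElt _

lemma linLift_comp_perm (a : ι → (lin k X ⟶ lin k Y)) (σ : Equiv.Perm ι) :
    linLift (a ∘ σ) = linLift a ≫ linMap k (Y.powReindex σ) :=
  lin_hom_ext fun n x => by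
    rw [NatTrans.comp_app, ModuleCat.comp_apply, linLift_basisElt, linLift_basisElt,
      ← extElt_comp_perm]
    rfl

lemma sum_app_apply {J : Type*} [Fintype J] (F : J → (lin k X ⟶ A)) {n : SimplexCategoryᵒᵖ}
    (z : (lin k X).obj n) : (∑ j, F j).app n z = ∑ j, (F j).app n z := by
  rw [NatTrans.app_sum]
  change (ModuleCat.Hom.hom _ : _ →ₗ[k] _) z = _
  rw [ModuleCat.hom_sum, LinearMap.sum_apply]

/-- On each simplex this is the expansion of a multilinear map at a sum, so `linLift` is additive in
each member of the family although it is built on the diagonal. -/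
lemma linLift_add [DecidableEq ι] (a b : ι → (lin k X ⟶ lin k Y)) :
    linLift (a + b) = ∑ s : Finset ι, linLift (s.piecewise a b) :=
  lin_hom_ext fun n x => by
    rw [linLift_basisElt]
    have h := (Finsupp.extProd k ι (Y.obj n)).map_add_univ
      (fun i => (a i).app n (basisElt k x)) (fun i => (b i).app n (basisElt k x))
    refine h.trans (Eq.trans ?_ (sum_app_apply (fun s : Finset ι => linLift (s.piecewise a b))
      (basisElt k x)).symm)
    refine Finset.sum_congr rfl fun s _ => ?_
    refine Eq.trans ?_ (linLift_basisElt _ x).symm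
    refine congrArg (Finsupp.extProd k ι (Y.obj n)) (funext fun i => ?_)
    by_cases hi : i ∈ s
    · exact (s.piecewise_eq_of_mem _ _ hi).trans
        (congrArg (fun f : lin k X ⟶ lin k Y => f.app n (basisElt k x)) (s.piecewise_eq_of_mem a b hi)).symm
    · exact (s.piecewise_eq_of_notMem _ _ hi).trans
        (congrArg (fun f : lin k X ⟶ lin k Y => f.app n (basisElt k x)) (s.piecewise_eq_of_notMem a b hi)).symm

lemma tensorCons_naturality {S T : Type*} {q : ℕ} (f : S → T) (x : S) (y : Fin q → S) :
    Finsupp.tensorCons k q T (TensorProduct.map (Finsupp.lmapDomain k k f)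
        (Finsupp.lmapDomain k k fun (y : Fin q → S) i => f (y i))
          (Finsupp.single x 1 ⊗ₜ Finsupp.single y 1)) =
      Finsupp.mapDomain (fun (y : Fin (q + 1) → S) i => f (y i)) (Finsupp.tensorCons k q S
        (Finsupp.single x 1 ⊗ₜ Finsupp.single y 1)) := by
  rw [TensorProduct.map_tmul, Finsupp.lmapDomain_apply, Finsupp.lmapDomain_apply,
    Finsupp.mapDomain_single, Finsupp.mapDomain_single, Finsupp.tensorCons_single,
    Finsupp.tensorCons_single, Finsupp.mapDomain_single]
  congr 1
  funext i
  induction i using Fin.cases <;> rfl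

/-- The external product of basis elements of a free simplicial module with elements of a free
simplicial module on a power. -/
def tensCons (k : Type) [Field k] (X : SSet.{u}) (q : ℕ) :
    tens (lin k X) (lin k (X.pow (Fin q))) ⟶ lin k (X.pow (Fin (q + 1))) where
  app n := ModuleCat.ofHom (Finsupp.tensorCons k q (X.obj n))
  naturality m n φ := by
    refine ModuleCat.hom_ext (TensorProduct.ext (Finsupp.lhom_ext' fun x => LinearMap.ext_ring
      (Finsupp.lhom_ext' fun y => LinearMap.ext_ring ?_)))
    exact tensorCons_naturality (X.map φ) x y

/-- The element of a tensor product given by two elements. -/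
def tmulElt {A B : SimplicialObject (ModuleCat.{u} k)} {n : SimplexCategoryᵒᵖ} (x : A.obj n)
    (y : B.obj n) : (tens A B).obj n :=
  (x ⊗ₜ[k] y : A.obj n ⊗[k] B.obj n)

lemma tensMap_tmulElt {A A' B B' : SimplicialObject (ModuleCat.{u} k)} (f : A ⟶ A') (g : B ⟶ B')
    {n : SimplexCategoryᵒᵖ} (x : A.obj n) (y : B.obj n) :
    (tensMap f g).app n (tmulElt x y) = tmulElt (f.app n x) (g.app n y) :=
  rfl

lemma tens_map_tmulElt {A B : SimplicialObject (ModuleCat.{u} k)} {m n : SimplexCategoryᵒᵖ}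
    (φ : m ⟶ n) (x : A.obj m) (y : B.obj m) :
    (tens A B).map φ (tmulElt x y) = tmulElt (A.map φ x) (B.map φ y) :=
  rfl

lemma tens_map_tmulElt_basisElt {m n : SimplexCategoryᵒᵖ} (φ : m ⟶ n) (q : ℕ) (x : X.obj m) :
    (tens (lin k X) (lin k (X.pow (Fin q)))).map φ
      (tmulElt (basisElt k x) (basisElt (X := X.pow (Fin q)) k fun _ => x)) =
    tmulElt (basisElt k (X.map φ x)) (basisElt (X := X.pow (Fin q)) k fun _ => X.map φ x) :=
  (tens_map_tmulElt _ _ _).trans (congr(tmulElt $(lin_map_basisElt φ x)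
      $(lin_map_basisElt (X := X.pow (Fin q)) (k := k) φ fun _ => x)))

/-- The diagonal of a free simplicial module. -/
def linDiag (k : Type) [Field k] (X : SSet.{u}) (q : ℕ) :
    lin k X ⟶ tens (lin k X) (lin k (X.pow (Fin q))) :=
  linDesc (fun _ x => tmulElt (basisElt k x) (basisElt (X := X.pow (Fin q)) k fun _ => x))
    fun φ x => tens_map_tmulElt_basisElt φ q x

lemma linDiag_basisElt (q : ℕ) {n : SimplexCategoryᵒᵖ} (x : X.obj n) :
    (linDiag k X q).app n (basisElt k x) =
      tmulElt (basisElt k x) (basisElt (X := X.pow (Fin q)) k fun _ => x) :=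
  linDesc_basisElt _ (fun φ x => tens_map_tmulElt_basisElt φ q x) x

/-- Splits one factor off an external power, so that vanishing results for a tensor product of two
simplicial modules apply to it. -/
lemma linLift_const_succ (q : ℕ) (h : lin k X ⟶ lin k Y) :
    linLift (fun _ : Fin (q + 1) => h) = linDiag k X q ≫
      tensMap h (linLift fun i => linMap k (SSet.powπ X i) ≫ h) ≫ tensCons k Y q :=
  lin_hom_ext fun n x => by
    have h₁ : (linLift fun i => linMap k (SSet.powπ X i) ≫ h).app n
        (basisElt (X := X.pow (Fin q)) k fun _ => x) =
        extElt fun _ : Fin q => h.app n (basisElt k x) :=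
      (linLift_basisElt _ _).trans (congrArg extElt (funext fun i =>
        congrArg (h.app n) (linMap_basisElt (SSet.powπ X i) _)))
    have h₂ := congrArg ((tensCons k Y q).app n)
      (congrArg ((tensMap h (linLift fun i => linMap k (SSet.powπ X i) ≫ h)).app n)
        (linDiag_basisElt (k := k) q x))
    refine (linLift_basisElt _ x).trans (Eq.trans ?_ h₂.symm)
    refine Eq.trans ?_ (congrArg ((tensCons k Y q).app n)
      ((tensMap_tmulElt _ _ _ _).trans (congrArg (tmulElt (h.app n (basisElt k x))) h₁))).symm
    refine Eq.trans ?_ (Finsupp.tensorCons_extProd (k := k) (S := Y.obj n) _ _).symm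
    refine congrArg (Finsupp.extProd k (Fin (q + 1)) (Y.obj n)) (funext fun i => ?_)
    induction i using Fin.cases <;> rfl

/-- An external product is a boundary in degree `0` if one of its factors is. -/
lemma extElt_mem_bdry (a : ι → (lin k Y).obj (op ⦋0⦌)) (i : ι)
    (hi : a i ∈ (chains (lin k Y)).bdry 0) :
    extElt a ∈ (chains (lin k (Y.pow ι))).bdry 0 := by
  classical
  obtain ⟨c, hc⟩ := hi
  have hd {Z : SSet.{u}} (c : (lin k Z).obj (op ⦋1⦌)) : (chains (lin k Z)).d 1 0 c =
      (lin k Z).δ 0 c - (lin k Z).δ 1 c := by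
    refine (d_apply (A := lin k Z) 0 c).trans ?_
    rw [Fin.sum_univ_two]
    simp [sub_eq_add_neg]
  have hc' : (lin k Y).δ 0 c - (lin k Y).δ 1 c = a i := (hd c).symm.trans hc
  -- Slot `i` carries a chain bounding `a i`, the other slots degenerate edges, both of whose faces
  -- give back `a j`; multilinearity in slot `i` computes the boundary.
  let b : ι → (lin k Y).obj (op ⦋1⦌) := Function.update (fun j => (lin k Y).σ 0 (a j)) i c
  refine ⟨extElt b, (hd (extElt b)).trans ?_⟩
  have hδ (j : Fin 2) : (lin k (Y.pow ι)).δ j (extElt b) =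
      Finsupp.extProd k ι (Y.obj (op ⦋0⦌)) (Function.update a i ((lin k Y).δ j c)) := by
    refine (lin_map_extElt _ b).trans (congrArg (Finsupp.extProd k ι _) (funext fun l => ?_))
    obtain rfl | hl := eq_or_ne l i
    · exact (congrArg ((lin k Y).δ j) (Function.update_self (f := fun j => (lin k Y).σ 0 (a j)) l c)).trans
        (Function.update_self (f := a) l ((lin k Y).δ j c)).symm
    · have h₁ : (lin k Y).σ 0 ≫ (lin k Y).δ j = 𝟙 _ := by
        fin_cases j
        · exact (lin k Y).δ_comp_σ_self (i := 0)
        · exact (lin k Y).δ_comp_σ_succ (i := 0)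
      have h₂ : b l = (lin k Y).σ 0 (a l) := Function.update_of_ne hl _ _
      refine (congrArg ((lin k Y).δ j) h₂).trans ?_
      exact congr($h₁ (a l)).trans (Function.update_of_ne hl _ a).symm
  have := (Finsupp.extProd k ι (Y.obj (op ⦋0⦌))).map_update_sub a i ((lin k Y).δ 0 c)
    ((lin k Y).δ 1 c)
  refine (congr($(hδ 0) - $(hδ 1))).trans (this.symm.trans ?_)
  exact congrArg (Finsupp.extProd k ι (Y.obj (op ⦋0⦌)))
    ((congrArg (Function.update a i) hc').trans (Function.update_eq_self i a))

/-- A property of the elements of a free module can be checked on the basis elements. -/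
lemma lin_range_le (f : lin k X ⟶ A) (n : SimplexCategoryᵒᵖ) (V : Submodule k (A.obj n))
    (h : ∀ x : X.obj n, f.app n (basisElt k x) ∈ V) (z : (lin k X).obj n) : f.app n z ∈ V := by
  have key (L : (X.obj n →₀ k) →ₗ[k] A.obj n) (h : ∀ x : X.obj n, L (Finsupp.single x 1) ∈ V)
      (z : X.obj n →₀ k) : L z ∈ V := by
    induction z using Finsupp.induction_linear with
    | zero => rw [map_zero]; exact zero_mem _
    | add x y hx hy => rw [map_add]; exact add_mem hx hy
    | single x r =>
      rw [← mul_one r, ← smul_eq_mul, ← Finsupp.smul_single, map_smul]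
      exact V.smul_mem _ (h x)
  exact key _ h z

lemma kills_zero_iff (f : lin k X ⟶ A) : Kills f 0 ↔
    ∀ x : X.obj (op ⦋0⦌), f.app (op ⦋0⦌) (basisElt k x) ∈ (chains A).bdry 0 :=
  ⟨fun h x => h _ (mem_cyc_zero (C := chains (lin k X)) (basisElt k x)),
    fun h z _ => lin_range_le f (op ⦋0⦌) ((chains A).bdry 0) h z⟩

lemma kills_linLift_zero (a : ι → (lin k X ⟶ lin k Y)) (i : ι) (hi : Kills (a i) 0) :
    Kills (linLift a) 0 := by
  rw [kills_zero_iff] at hi ⊢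
  intro x
  rw [linLift_basisElt]
  exact extElt_mem_bdry (fun i => (a i).app (op ⦋0⦌) (basisElt k x)) i (hi x)

end SimplicialModule

/-! ### Collapsing components to vertices -/

namespace SSet

/-- A section of the map from a simplicial set to its set of connected components. -/
def pi0Section (X : SSet.{u}) : X.discretePi0 ⟶ X :=
  SimplicialObject.constHom (↾fun c => (π₀.mk_surjective c).choose)

lemma toPi0_app_zero {X : SSet.{u}} (x : X _⦋0⦌) : X.toPi0.app (Opposite.op ⦋0⦌) x = π₀.mk x := by
  refine congrArg π₀.mk ?_
  have : SimplexCategory.const ⦋0⦌ ⦋0⦌ 0 = 𝟙 _ := Subsingleton.elim _ _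
  change X.map (SimplexCategory.const ⦋0⦌ ⦋0⦌ 0).op _ = _
  rw [this]
  exact congr($(X.map_id _) _)

lemma pi0Section_toPi0 (X : SSet.{u}) : X.pi0Section ≫ X.toPi0 = 𝟙 _ := by
  refine SimplicialObject.const_hom_ext ?_
  ext c
  have h : π₀.mk (π₀.mk_surjective c).choose = c := (π₀.mk_surjective c).choose_spec
  refine Eq.trans ?_ h
  have h₁ : X.pi0Section.app (Opposite.op ⦋0⦌) c = (π₀.mk_surjective c).choose :=
    congr($(SimplicialObject.constHom_app_zero
      (↾fun c : X.π₀ => (π₀.mk_surjective c).choose : X.π₀ ⟶ X _⦋0⦌)) c)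
  exact (toPi0_app_zero _).trans (congrArg π₀.mk h₁)

lemma toPi0_naturality {X Y : SSet.{u}} (f : X ⟶ Y) :
    f ≫ Y.toPi0 = X.toPi0 ≫ (SimplicialObject.const (Type u)).map (↾mapπ₀ f) := by
  ext n x
  change π₀.mk (Y.map _ (f.app n x)) = π₀.mk (f.app _ (X.map _ x))
  rw [NatTrans.naturality_apply]

/-- The idempotent endomorphism of a simplicial set which collapses each component to a vertex. -/
def collapsePi0 (X : SSet.{u}) : X ⟶ X := X.toPi0 ≫ X.pi0Section

/-- `f ≫ Y.collapsePi0` depends only on the component of a simplex, which `X.collapsePi0` preserves.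
-/
lemma collapsePi0_comp_comp {X Y : SSet.{u}} (f : X ⟶ Y) :
    X.collapsePi0 ≫ f ≫ Y.collapsePi0 = f ≫ Y.collapsePi0 := by
  have h := toPi0_naturality f
  rw [collapsePi0, collapsePi0, reassoc_of% h, Category.assoc,
    reassoc_of% X.pi0Section_toPi0]

end SSet

namespace SimplicialModule

open Opposite ChainComplex SSet

variable {k : Type} [Field k]

/-- The homology functors of simplicial modules. -/
abbrev H (k : Type) [Field k] (n : ℕ) : SimplicialObject (ModuleCat.{u} k) ⥤ ModuleCat.{u} k :=
  AlgebraicTopology.alternatingFaceMapComplex _ ⋙ HomologicalComplex.homologyFunctor _ _ n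

variable {X Y : SSet.{u}} {A B : SimplicialObject (ModuleCat.{u} k)}

lemma kills_iff_map_eq_zero (f : A ⟶ B) (n : ℕ) : Kills f n ↔ (H k n).map f = 0 :=
  ChainComplex.kills_iff _ _

lemma map_linMap_eq_of_toHo {f g : X ⟶ Y} (h : toHo.map f = toHo.map g) (n : ℕ) :
    (H k n).map (linMap k f) = (H k n).map (linMap k g) := by
  let F := CategoryTheory.Quotient.lift homotopyRel.{u} (linFunctor k ⋙ H k n)
    (fun _ _ _ _ ⟨h⟩ =>
      (h.toSimplicialObjectHomotopy.whiskerRight (freeModule k)).toChainHomotopy.homologyMap_eq n)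
  exact congrArg F.map h

lemma linMap_comp {Z : SSet.{u}} (f : X ⟶ Y) (g : Y ⟶ Z) :
    linMap k (f ≫ g) = linMap k f ≫ linMap k g :=
  CategoryTheory.Functor.map_comp _ _ _

lemma linMap_id (X : SSet.{u}) : linMap k (𝟙 X) = 𝟙 _ := CategoryTheory.Functor.map_id _ _

/-- All faces are identities, so the alternating sums make the differentials alternately zero and
the identity. -/
lemma kills_id_lin_const (S : Type u) {n : ℕ} (hn : 1 ≤ n) :
    Kills (𝟙 (lin k ((SimplicialObject.const _).obj S))) n := by
  set A := lin k ((SimplicialObject.const (Type u)).obj S)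
  have hδ {m : ℕ} (i : Fin (m + 2)) (z : (S →₀ k)) : A.δ (n := m) i z = z :=
    Finsupp.mapDomain_id
  have hd (m : ℕ) (z : S →₀ k) : (chains A).d (m + 1) m z =
      if Even (m + 2) then 0 else z := by
    refine (d_apply (A := A) m z).trans ?_
    refine (Finset.sum_congr rfl fun (i : Fin (m + 2)) _ =>
      congrArg ((-1 : ℤ) ^ (i : ℕ) • ·) (hδ i z)).trans ?_
    have key : ∑ i : Fin (m + 2), (-1 : ℤ) ^ (i : ℕ) • z = if Even (m + 2) then 0 else z := by
      rw [← Finset.sum_smul, Fin.sum_neg_one_pow]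
      split_ifs <;> simp
    exact key
  intro z hz
  obtain ⟨m, rfl⟩ := Nat.exists_eq_add_of_le' hn
  by_cases he : Even (m + 2)
  · refine ⟨z, (hd (m + 1) z).trans (if_neg ?_)⟩
    rw [Nat.even_add_one]
    exact not_not.2 he
  · have h₁ : (chains A).d (m + 1) m z = z := (hd m z).trans (if_neg he)
    have h₂ : z = 0 := h₁.symm.trans hz
    rw [h₂]
    exact zero_mem _

lemma Kills.comp_left {C : SimplicialObject (ModuleCat.{u} k)} {f : A ⟶ B} {n : ℕ}
    (h : Kills f n) (g : B ⟶ C) : Kills (f ≫ g) n := by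
  rw [Kills, chainsMap_comp]
  exact ChainComplex.Kills.comp_left h _

lemma Kills.comp_right {C : SimplicialObject (ModuleCat.{u} k)} {g : B ⟶ C} {n : ℕ}
    (h : Kills g n) (f : A ⟶ B) : Kills (f ≫ g) n := by
  rw [Kills, chainsMap_comp]
  exact ChainComplex.Kills.comp_right h _

lemma kills_linMap_collapsePi0_comp (f : X ⟶ Y) {n : ℕ} (hn : 1 ≤ n) :
    Kills (linMap k (X.collapsePi0 ≫ f)) n := by
  have h := ((kills_id_lin_const (k := k) X.π₀ hn).comp_right
    (linMap k X.toPi0)).comp_left (linMap k (X.pi0Section ≫ f))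
  rw [Category.comp_id, ← linMap_comp, ← Category.assoc] at h
  exact h

lemma basisElt_sub_mem_bdry {x y : X _⦋0⦌} (h : π₀.mk x = π₀.mk y) :
    basisElt k x - basisElt k y ∈ (chains (lin k X)).bdry 0 := by
  rw [π₀.mk_eq_mk_iff] at h
  induction h with
  | rel x y h =>
    obtain ⟨e⟩ := h
    have : (chains (lin k X)).d 1 0 (basisElt k e.edge) = basisElt k y - basisElt k x := by
      refine (d_apply (A := lin k X) 0 _).trans ?_
      rw [Fin.sum_univ_two]
      have h₀ : (lin k X).δ 0 (basisElt k e.edge) = basisElt k y :=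
        (lin_map_basisElt _ _).trans (congrArg (basisElt k) e.tgt_eq)
      have h₁ : (lin k X).δ 1 (basisElt k e.edge) = basisElt k x :=
        (lin_map_basisElt _ _).trans (congrArg (basisElt k) e.src_eq)
      rw [h₀, h₁]
      simp [sub_eq_add_neg]
    rw [← neg_sub, ← this]
    exact neg_mem (d_mem_bdry _)
  | refl x => rw [sub_self]; exact zero_mem _
  | symm x y _ ih => rw [← neg_sub]; exact neg_mem ih
  | trans x y z _ _ h₁ h₂ => rw [← sub_add_sub_cancel _ (basisElt k y)]; exact add_mem h₁ h₂

/-- A vertex and its collapse lie in one component, so a path of edges bounds their difference. -/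
lemma kills_id_sub_linMap_collapsePi0 :
    Kills (𝟙 (lin k X) - linMap k X.collapsePi0) 0 := by
  rw [kills_zero_iff]
  intro x
  have : (𝟙 (lin k X) - linMap k X.collapsePi0).app (op ⦋0⦌) (basisElt k x) =
      basisElt k x - basisElt k (X.collapsePi0.app (op ⦋0⦌) x) :=
    congrArg (basisElt k x - ·) (linMap_basisElt _ x)
  rw [this]
  refine basisElt_sub_mem_bdry ?_
  rw [← toPi0_app_zero, ← toPi0_app_zero]
  have h₁ : X.collapsePi0 ≫ X.toPi0 = X.toPi0 := by
    rw [collapsePi0, Category.assoc, pi0Section_toPi0, Category.comp_id]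
  exact congr(($h₁.symm).app (op ⦋0⦌) x)

end SimplicialModule

/-! ### Nilpotence of multiplication by `p` on mod `p` homology -/

lemma Finset.sum_univ_eq_of_card {p : ℕ} (hp : p.Prime) {V : Type*} [AddCommGroup V]
    (hV : ∀ x : V, p • x = 0) (F : Finset (Fin p) → V)
    (hF : ∀ s t : Finset (Fin p), s.card = t.card → F s = F t) :
    ∑ s, F s = F ∅ + F Finset.univ := by
  obtain ⟨f, hf⟩ : ∃ f : ℕ → V, ∀ s, F s = f s.card :=
    ⟨Function.extend Finset.card F 0, fun s => ((Function.FactorsThrough.extend_apply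
      (fun s t h => hF s t h) 0 s)).symm⟩
  simp_rw [hf]
  rw [← Finset.powerset_univ, Finset.sum_powerset_apply_card, Finset.card_univ, Fintype.card_fin,
    Finset.sum_range_succ, Finset.sum_range_eq_add_Ico _ hp.pos, Finset.sum_eq_zero]
  · simp
  -- There are `p.choose m` subsets of size `m`, a multiple of `p` for `0 < m < p`.
  · intro m hm
    rw [Finset.mem_Ico] at hm
    obtain ⟨c, hc⟩ := hp.dvd_choose_self (by omega) hm.2
    rw [hc, mul_smul, hV]

lemma Finset.exists_perm_of_card_eq {ι : Type*} [Fintype ι] [DecidableEq ι] {s t : Finset ι}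
    (h : s.card = t.card) : ∃ σ : Equiv.Perm ι, ∀ i, σ i ∈ t ↔ i ∈ s := by
  let e : {x // x ∈ s} ≃ {x // x ∈ t} := Finset.equivOfCardEq h
  refine ⟨e.extendSubtype, fun i => ?_⟩
  by_cases hi : i ∈ s
  · exact ⟨fun _ => hi, fun _ => e.extendSubtype_mem i hi⟩
  · exact ⟨fun h => (e.extendSubtype_not_mem i hi h).elim, fun h => (hi h).elim⟩

namespace SimplicialModule

open Opposite ChainComplex SSet

variable {k : Type} [Field k] {X Y : SSet.{u}} {p : ℕ}

/-- Write the external power as `h ⊗ h^q`. The first factor is `uⁿ` with `u` vanishing below `n`;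
the second vanishes in degree `0`, since `n ≥ 1` puts a factor `u` into `h` and `q ≥ 1` puts an `h`
into `h^q`. -/
lemma kills_linLift_const {u : End (lin k X)} {n q : ℕ} (hn : 1 ≤ n) (hq : 1 ≤ q)
    (hu : ∀ i < n, Kills (u : lin k X ⟶ lin k X) i) {h : lin k X ⟶ lin k X} (hh : h = u ^ n) :
    Kills (linLift fun _ : Fin (q + 1) => h) n := by
  have hu₀ : Kills h 0 := by
    obtain ⟨m, rfl⟩ := Nat.exists_eq_add_of_le' hn
    rw [hh, pow_succ']
    exact (hu 0 (by omega)).comp_right (u ^ m : End (lin k X))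
  have h₁ := kills_linLift_zero (fun i : Fin q => linMap k (SSet.powπ X i) ≫ h) ⟨0, hq⟩
    (hu₀.comp_right _)
  have h₂ := kills_tensMap_pow_of_kills_zero hu h₁
  rw [← hh] at h₂
  rw [linLift_const_succ]
  exact (h₂.comp_left _).comp_right _

/-- Over a field of characteristic `p`, a map invariant under permutations of its `p` arguments is
additive on diagonal classes. -/
lemma kills_linLift_const_add (hp : p.Prime) [CharP k p] {μ : X.pow (Fin p) ⟶ Y} {n : ℕ}
    (hμ : ∀ σ : Equiv.Perm (Fin p), (H k n).map (linMap k (powReindex _ σ ≫ μ)) =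
      (H k n).map (linMap k μ)) (a b : lin k X ⟶ lin k X)
    (ha : Kills (linLift fun _ : Fin p => a) n) (hb : Kills (linLift fun _ : Fin p => b) n) :
    Kills ((linLift fun _ : Fin p => a + b) ≫ linMap k μ) n := by
  let W (s : Finset (Fin p)) : lin k X ⟶ lin k (X.pow (Fin p)) :=
    linLift (s.piecewise (fun _ => a) fun _ => b)
  have h₁ : (linLift fun _ : Fin p => a + b) = ∑ s, W s := linLift_add _ _
  rw [kills_iff_map_eq_zero] at ha hb ⊢
  have hW : ∀ s t : Finset (Fin p), s.card = t.card →
      (H k n).map (W s ≫ linMap k μ) = (H k n).map (W t ≫ linMap k μ) := by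
    intro s t hst
    -- Terms for subsets of equal size differ by a permutation of the factors, which `μ` does not
    -- see on homology.
    obtain ⟨σ, hσ⟩ := Finset.exists_perm_of_card_eq hst
    have h₂ : W s = W t ≫ linMap k (powReindex _ σ) := by
      refine Eq.trans ?_ (linLift_comp_perm _ σ)
      refine congrArg linLift (funext fun i => ?_)
      by_cases hi : i ∈ s
      · simp [hi, (hσ i).2 hi]
      · simp [hi, mt (hσ i).1 hi]
    rw [h₂, Category.assoc, ← linMap_comp, CategoryTheory.Functor.map_comp, hμ,
      ← CategoryTheory.Functor.map_comp]
  have hV (x : (H k n).obj (lin k X) ⟶ (H k n).obj (lin k Y)) : p • x = 0 := by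
    rw [← Nat.cast_smul_eq_nsmul k, CharP.cast_eq_zero, zero_smul]
  rw [h₁, Preadditive.sum_comp, Functor.map_sum]
  refine (Finset.sum_univ_eq_of_card hp hV _ hW).trans ?_
  have h₂ : W ∅ = linLift fun _ => b := by simp [W]
  have h₃ : W Finset.univ = linLift fun _ => a := by simp [W]
  rw [h₂, h₃, CategoryTheory.Functor.map_comp, CategoryTheory.Functor.map_comp, ha, hb, zero_comp,
    add_zero]

lemma map_comp_pow {μ : X.pow (Fin p) ⟶ X} {P : End X} {n : ℕ}
    (h : (H k n).map (linMap k (μ ≫ P)) = (H k n).map (linMap k (powMap P (Fin p) ≫ μ))) (m : ℕ) :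
    (H k n).map (linMap k (μ ≫ (P ^ m : End X))) =
      (H k n).map (linMap k (powMap (P ^ m : End X) (Fin p) ≫ μ)) := by
  induction m with
  | zero =>
    rw [pow_zero]
    rfl
  | succ m ih =>
    have h₁ : (P ^ (m + 1) : End X) = P ≫ (P ^ m : End X) := pow_succ _ _
    have h₂ : powMap (P ^ (m + 1) : End X) (Fin p) =
        powMap P (Fin p) ≫ powMap (P ^ m : End X) _ := by
      rw [h₁]
      rfl
    rw [h₂, h₁, ← Category.assoc, linMap_comp, CategoryTheory.Functor.map_comp, h,
      ← CategoryTheory.Functor.map_comp, ← linMap_comp, Category.assoc, linMap_comp,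
      CategoryTheory.Functor.map_comp, ih, ← CategoryTheory.Functor.map_comp, ← linMap_comp,
      Category.assoc]

lemma linMap_pow_add (P : End X) (a b : ℕ) : linMap k (P ^ (a + b) : End X) =
    linMap k (P ^ a : End X) ≫ linMap k (P ^ b : End X) := by
  rw [add_comm, pow_add, ← linMap_comp]
  rfl

/-- Away from degree `0`, a power of an endomorphism that vanishes on homology below a given degree
can be replaced by a power of an endomorphism that also vanishes on homology in degree `0`. -/
lemma exists_pow_eq_add {Q : End X} {n : ℕ} (hn : 1 ≤ n)
    (hQ : ∀ i, 1 ≤ i → i < n → Kills (linMap k Q) i) :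
    ∃ u : End (lin k X), (∀ i < n, Kills (u : lin k X ⟶ lin k X) i) ∧
      linMap k (Q ^ n : End X) = (show lin k X ⟶ lin k X from u ^ n) +
        linMap k (X.collapsePi0 ≫ (Q ^ n : End X)) := by
  let r : lin k X ⟶ lin k X := linMap k X.collapsePi0
  let u : lin k X ⟶ lin k X := (𝟙 _ - r) ≫ linMap k Q
  have hu : ∀ i < n, Kills u i := by
    intro i hi
    obtain rfl | hi' := i.eq_zero_or_pos
    · exact kills_id_sub_linMap_collapsePi0.comp_left _
    · exact (hQ i hi' hi).comp_right _
  -- Since `r ≫ Q ≫ r = Q ≫ r`, the factors `1 - r` inside a power of `u` are absorbed and only the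
  -- first one survives.
  have hur : u ≫ (𝟙 _ - r) = u := by
    have : r ≫ linMap k Q ≫ r = linMap k Q ≫ r := by
      simp only [r, ← linMap_comp]
      rw [collapsePi0_comp_comp]
    simp only [u, Category.assoc, Preadditive.sub_comp, Preadditive.comp_sub, Category.id_comp,
      Category.comp_id, this, sub_self, sub_zero]
  have hun (m : ℕ) : (End.of u ^ (m + 1) : End (lin k X)) =
      (𝟙 _ - r) ≫ linMap k (Q ^ (m + 1) : End X) := by
    induction m with
    | zero => rw [zero_add, pow_one, pow_one]
    | succ m ih =>
      have e₁ : (End.of u ^ (m + 1 + 1) : End (lin k X)) =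
        u ≫ (End.of u ^ (m + 1) : End (lin k X)) := pow_succ _ _
      have e₂ : (Q ^ (m + 1 + 1) : End X) = Q ≫ (Q ^ (m + 1) : End X) := pow_succ _ _
      rw [e₁, e₂, ih, ← Category.assoc, hur, linMap_comp, ← Category.assoc]
  refine ⟨End.of u, hu, ?_⟩
  obtain ⟨m, rfl⟩ := Nat.exists_eq_add_of_le' hn
  rw [hun, linMap_comp]
  change _ = (𝟙 _ - r) ≫ linMap k (Q ^ (m + 1) : End X) + r ≫ linMap k (Q ^ (m + 1) : End X)
  rw [Preadditive.sub_comp, Category.id_comp, sub_add_cancel]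

/-- The collapse is a map of spaces, so it can be performed once before the diagonal, and the whole
map factors through a discrete space. -/
lemma kills_linLift_collapsePi0_comp {ι : Type} [Fintype ι] (f : ι → (X ⟶ Y)) {n : ℕ}
    (hn : 1 ≤ n) : Kills (linLift fun i => linMap k (X.collapsePi0 ≫ f i)) n := by
  rw [linLift_linMap, ← comp_powLift]
  exact kills_linMap_collapsePi0_comp _ hn

/-- The homology of a homotopy commutative monoid is killed by powers of the multiplication by `p`
in positive degrees, with coefficients in a field of characteristic `p`. -/
theorem exists_kills_pow (hp : p.Prime) [CharP k p] {μ : X.pow (Fin p) ⟶ X} {P : End X}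
    (hP : P = powDiag X (Fin p) ≫ μ)
    (h₁ : ∀ n, (H k n).map (linMap k (μ ≫ P)) = (H k n).map (linMap k (powMap P (Fin p) ≫ μ)))
    (h₂ : ∀ n, ∀ σ : Equiv.Perm (Fin p), (H k n).map (linMap k (powReindex _ σ ≫ μ)) =
      (H k n).map (linMap k μ)) (n : ℕ) :
    ∃ N : ℕ, ∀ i, 1 ≤ i → i < n → Kills (linMap k (P ^ N : End X)) i := by
  induction n with
  | zero => exact ⟨0, by simp⟩
  | succ n ih =>
    obtain ⟨N, hN⟩ := ih
    obtain rfl | hn := n.eq_zero_or_pos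
    · exact ⟨0, by omega⟩
    suffices ∃ K, Kills (linMap k (P ^ K : End X)) n by
      obtain ⟨K, hK⟩ := this
      refine ⟨N + K, fun i h₁ h₂ => ?_⟩
      rw [linMap_pow_add]
      obtain rfl | hi := eq_or_lt_of_le (Nat.lt_succ_iff.1 h₂)
      · exact hK.comp_right _
      · exact (hN i h₁ hi).comp_left _
    -- Here `Q = P ^ N`.
    obtain ⟨u, hu, hQ⟩ := exists_pow_eq_add hn hN
    obtain ⟨q, rfl⟩ := Nat.exists_eq_add_of_le' hp.one_le
    have key := kills_linLift_const_add hp (h₂ n) _ _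
      (kills_linLift_const hn (by have := hp.two_le; omega) hu rfl)
      (kills_linLift_collapsePi0_comp (fun _ => ((P ^ N : End X) ^ n : End X)) hn)
    rw [← hQ, linLift_linMap, ← linMap_comp, kills_iff_map_eq_zero] at key
    -- One factor `P` supplies the diagonal and `μ`; the remaining `P ^ (N * n) = Qⁿ` is moved
    -- across `μ` onto each of the `p` factors, which gives the map in `key`.
    refine ⟨1 + N * n, ?_⟩
    have e := map_comp_pow (h₁ n) (N * n)
    rw [kills_iff_map_eq_zero, linMap_pow_add, pow_one, ← linMap_comp, hP, Category.assoc,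
      ← hP, linMap_comp, CategoryTheory.Functor.map_comp, e, ← CategoryTheory.Functor.map_comp,
      ← linMap_comp, pow_mul]
    exact key

end SimplicialModule

/-! ### Homology of a cylinder glued along two maps -/

lemma Finsupp.exists_of_mapDomain_add_eq_zero {k : Type} [Field k] {E C V T : Type u}
    {e₀ e₁ : E → C} {a b : E → V} {i : C → T} {j : V → T}
    (hdesc : ∀ (Q : Type u) (f : C → Q) (g : V → Q), (∀ e, f (e₀ e) = g (a e)) →
      (∀ e, f (e₁ e) = g (b e)) → ∃ h : T → Q, (∀ x, h (i x) = f x) ∧ ∀ y, h (j y) = g y)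
    {x : C →₀ k} {y : V →₀ k} (hxy : mapDomain i x + mapDomain j y = 0) :
    ∃ w₀ w₁ : E →₀ k, mapDomain e₀ w₀ + mapDomain e₁ w₁ = x ∧
      mapDomain a w₀ + mapDomain b w₁ = -y := by
  -- The gluing relations, linearised. Applying the set-level universal property of `T` to the
  -- quotient by their span shows that this span contains every relation in the free module on `T`.
  let φ : (E →₀ k) × (E →₀ k) →ₗ[k] (C →₀ k) × (V →₀ k) :=
    ((lmapDomain k k e₀).prod (-lmapDomain k k a)).coprod
      ((lmapDomain k k e₁).prod (-lmapDomain k k b))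
  obtain ⟨h, h₁, h₂⟩ := hdesc (((C →₀ k) × (V →₀ k)) ⧸ LinearMap.range φ)
    (fun c => (LinearMap.range φ).mkQ (single c 1, 0))
    (fun v => (LinearMap.range φ).mkQ (0, single v 1))
    (fun e => by
      rw [← sub_eq_zero, ← map_sub, Submodule.mkQ_apply, Submodule.Quotient.mk_eq_zero]
      exact ⟨(single e 1, 0), by simp [φ]⟩)
    (fun e => by
      rw [← sub_eq_zero, ← map_sub, Submodule.mkQ_apply, Submodule.Quotient.mk_eq_zero]
      exact ⟨(0, single e 1), by simp [φ]⟩)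
  have e₁ : linearCombination k h ∘ₗ lmapDomain k k i =
      (LinearMap.range φ).mkQ ∘ₗ LinearMap.inl k _ _ := by
    ext c : 2
    simp [h₁]
  have e₂ : linearCombination k h ∘ₗ lmapDomain k k j =
      (LinearMap.range φ).mkQ ∘ₗ LinearMap.inr k _ _ := by
    ext c : 2
    simp [h₂]
  have h₃ : (LinearMap.range φ).mkQ (x, y) = 0 := by
    have := congrArg (linearCombination k h) hxy
    rw [map_zero, map_add] at this
    rw [← this]
    refine Eq.trans ?_ (congr($e₁ x + $e₂ y)).symm
    change _ = (LinearMap.range φ).mkQ _ + (LinearMap.range φ).mkQ _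
    rw [← map_add]
    simp
  rw [Submodule.mkQ_apply, Submodule.Quotient.mk_eq_zero] at h₃
  obtain ⟨⟨w₀, w₁⟩, hw⟩ := h₃
  have hw' : ((mapDomain e₀ w₀ + mapDomain _ w₁, -mapDomain a w₀ + -mapDomain b w₁) :
    (C →₀ k) × (V →₀ k)) = (x, y) := hw
  rw [Prod.mk.injEq] at hw'
  exact ⟨w₀, w₁, hw'.1, by rw [← hw'.2]; abel⟩

lemma Finsupp.eq_zero_of_mapDomain_add_eq_zero {k : Type*} [Field k] {E C : Type*} {f g : E → C}
    (hf : f.Injective) (hfg : ∀ x y, f x ≠ g y) {w w' : E →₀ k}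
    (h : mapDomain f w + mapDomain g w' = 0) : w = 0 := by
  ext e
  have := congr($h (f e))
  rw [add_apply, mapDomain_apply hf, mapDomain_of_notMem_range _ _ (by
    rintro ⟨y, hy⟩
    exact hfg _ _ hy.symm), add_zero] at this
  exact this

namespace SSet

/-- The minimum of two simplices of `Δ¹`. -/
def minΔ₁ : (Δ[1] ⊗ Δ[1] : SSet.{u}) ⟶ Δ[1] where
  app _ := ↾fun x => stdSimplex.objEquiv.symm (SimplexCategory.Hom.mk
    ((stdSimplex.objEquiv x.1).toOrderHom ⊓ (stdSimplex.objEquiv x.2).toOrderHom))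
  naturality _ _ _ := rfl

/-- The cylinder can be deformed to one of its ends. -/
def cylinderHomotopy (X : SSet.{u}) :
    Homotopy (CartesianMonoidalCategory.fst X Δ[1] ≫ ι₀) (𝟙 (X ⊗ Δ[1])) where
  h := CartesianMonoidalCategory.lift
    (CartesianMonoidalCategory.fst _ _ ≫ CartesianMonoidalCategory.fst _ _)
    (CartesianMonoidalCategory.lift
      (CartesianMonoidalCategory.fst _ _ ≫ CartesianMonoidalCategory.snd _ _)
      (CartesianMonoidalCategory.snd _ _) ≫ minΔ₁)
  h₀ := by
    refine NatTrans.ext (funext fun n => ?_)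
    ext x
    refine Prod.ext rfl ?_
    refine stdSimplex.objEquiv.injective ?_
    ext i : 3
    exact min_eq_right (Fin.zero_le _)
  h₁ := by
    refine NatTrans.ext (funext fun n => ?_)
    ext x
    refine Prod.ext rfl ?_
    refine stdSimplex.objEquiv.injective ?_
    ext i : 3
    exact min_eq_left (Fin.le_last _)
  rel := by
    refine NatTrans.ext (funext fun n => ?_)
    ext x
    exact x.1.2.elim

/-- The two ends of the cylinder are homotopic. -/
def cylinderEndsHomotopy (X : SSet.{u}) : Homotopy (ι₀ (X := X)) ι₁ where
  h := 𝟙 _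
  rel := by
    refine NatTrans.ext (funext fun n => ?_)
    ext x
    exact x.1.2.elim

/-- A simplicial set obtained by gluing a cylinder along two maps. -/
structure IsHocoeq {E V T : SSet.{u}} (a b : E ⟶ V) (i : E ⊗ Δ[1] ⟶ T) (j : V ⟶ T) : Prop where
  comm₀ : ι₀ ≫ i = a ≫ j
  comm₁ : ι₁ ≫ i = b ≫ j
  exists_desc : ∀ (n : SimplexCategoryᵒᵖ) (Q : Type u) (f : (E ⊗ Δ[1]).obj n → Q)
    (g : V.obj n → Q), (∀ e, f (ι₀.app n e) = g (a.app n e)) →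
      (∀ e, f (ι₁.app n e) = g (b.app n e)) →
      ∃ h : T.obj n → Q, (∀ x, h (i.app n x) = f x) ∧ ∀ y, h (j.app n y) = g y
  exists_eq : ∀ (n : SimplexCategoryᵒᵖ) (t : T.obj n),
    (∃ x, i.app n x = t) ∨ ∃ y, j.app n y = t

end SSet

namespace SimplicialModule

open Opposite ChainComplex SSet

variable {k : Type} [Field k]

section

variable {A B C : SimplicialObject (ModuleCat.{u} k)}

/-- The linear map on chains induced by a map of simplicial modules. -/
def ap (f : A ⟶ B) (n : ℕ) : (chains A).X n →ₗ[k] (chains B).X n := ((chainsMap f).f n).hom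

/-- The differential as a linear map. -/
def del (A : SimplicialObject (ModuleCat.{u} k)) (n : ℕ) :
    (chains A).X (n + 1) →ₗ[k] (chains A).X n := ((chains A).d (n + 1) n).hom

lemma ap_comp (f : A ⟶ B) (g : B ⟶ C) (n : ℕ) (x : (chains A).X n) :
    ap (f ≫ g) n x = ap g n (ap f n x) := rfl

lemma ap_id (n : ℕ) (x : (chains A).X n) : ap (𝟙 A) n x = x := rfl

lemma ap_sub (f g : A ⟶ B) (n : ℕ) (x : (chains A).X n) : ap (f - g) n x = ap f n x - ap g n x :=
  rfl

lemma del_ap (f : A ⟶ B) (n : ℕ) (x : (chains A).X (n + 1)) :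
    del B n (ap f (n + 1) x) = ap f n (del A n x) := d_f_apply _ _ _ _

lemma del_del (n : ℕ) (x : (chains A).X (n + 1 + 1)) : del A n (del A (n + 1) x) = 0 :=
  congr($((chains A).d_comp_d (n + 1 + 1) (n + 1) n) x)

lemma ap_mem_cyc (f : A ⟶ B) {n : ℕ} {x : (chains A).X n} (hx : x ∈ (chains A).cyc n) :
    ap f n x ∈ (chains B).cyc n := map_mem_cyc _ hx

lemma ap_mem_bdry (f : A ⟶ B) {n : ℕ} {x : (chains A).X n} (hx : x ∈ (chains A).bdry n) :
    ap f n x ∈ (chains B).bdry n := map_mem_bdry _ hx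

lemma ap_sub_ap_mem_bdry {f g : A ⟶ B} {n : ℕ} (h : (H k n).map f = (H k n).map g)
    {x : (chains A).X n} (hx : x ∈ (chains A).cyc n) : ap f n x - ap g n x ∈ (chains B).bdry n := by
  rw [← sub_eq_zero, ← Functor.map_sub, ← kills_iff_map_eq_zero] at h
  exact h x hx

end

variable {E V T : SSet.{u}} {a b : E ⟶ V} {i : E ⊗ Δ[1] ⟶ T} {j : V ⟶ T}

lemma exists_eq_ap_add_ap (h : IsHocoeq a b i j) (n : ℕ) (t : (chains (lin k T)).X n) :
    ∃ x y, ap (linMap k i) n x + ap (linMap k j) n y = t := by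
  suffices ⊤ ≤ LinearMap.range (ap (linMap k i) n) ⊔ LinearMap.range (ap (linMap k j) n) by
    obtain ⟨_, ⟨x, rfl⟩, _, ⟨y, rfl⟩, h⟩ := Submodule.mem_sup.1 (this (Submodule.mem_top (x := t)))
    exact ⟨x, y, h⟩
  intro t _
  refine lin_range_le (𝟙 _) (op ⦋n⦌) (LinearMap.range (ap (linMap k i) n) ⊔
    LinearMap.range (ap (linMap k j) n)) (fun t => ?_) t
  obtain ⟨x, rfl⟩ | ⟨y, rfl⟩ := h.exists_eq _ t
  · exact Submodule.mem_sup_left ⟨basisElt k x, linMap_basisElt i x⟩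
  · exact Submodule.mem_sup_right ⟨basisElt k y, linMap_basisElt j y⟩

lemma exists_of_ap_add_ap_eq_zero (h : IsHocoeq a b i j) {n : ℕ}
    {x : (chains (lin k (E ⊗ Δ[1]))).X n} {y : (chains (lin k V)).X n}
    (hxy : ap (linMap k i) n x + ap (linMap k j) n y = 0) :
    ∃ w₀ w₁, ap (linMap k ι₀) n w₀ + ap (linMap k ι₁) n w₁ = x ∧
      ap (linMap k a) n w₀ + ap (linMap k b) n w₁ = -y :=
  Finsupp.exists_of_mapDomain_add_eq_zero (h.exists_desc (op ⦋n⦌)) hxy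

/-- The two ends of the cylinder are embedded disjointly. -/
lemma eq_zero_of_ap_ι₀_add_ap_ι₁ {n : ℕ} {w₀ w₁ : (chains (lin k E)).X n}
    (h : ap (linMap k ι₀) n w₀ + ap (linMap k ι₁) n w₁ = 0) : w₀ = 0 ∧ w₁ = 0 := by
  have h₁ : w₀ + w₁ = 0 := by
    have := congrArg (ap (linMap k (CartesianMonoidalCategory.fst E Δ[1])) n) h
    rw [map_add, ← ap_comp, ← ap_comp, ← linMap_comp, ← linMap_comp, ι₀_fst, ι₁_fst, linMap_id,
      ap_id, ap_id, map_zero] at this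
    exact this
  have h₀ : w₀ = 0 := by
    refine Finsupp.eq_zero_of_mapDomain_add_eq_zero (f := (ι₀ (X := E)).app (op ⦋n⦌))
      (g := (ι₁ (X := E)).app (op ⦋n⦌)) (fun x y h => congrArg Prod.fst h) (fun x y h => ?_) h
    have h₂ := congrArg (fun z : (E ⊗ Δ[1] : SSet.{u}).obj (op ⦋n⦌) => z.2 0) h
    exact zero_ne_one (α := Fin 2) h₂
  exact ⟨h₀, by simpa [h₀] using h₁⟩

/-- The homology of a homotopy coequalizer vanishes if the difference of the two maps is surjective
on homology, and injective on homology in the degree below. -/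
lemma cyc_le_bdry_of_isHocoeq (h : IsHocoeq a b i j) (n : ℕ)
    (hs : ∀ y ∈ (chains (lin k V)).cyc (n + 1), ∃ e ∈ (chains (lin k E)).cyc (n + 1),
      ap (linMap k a) _ e - ap (linMap k b) _ e - y ∈ (chains (lin k V)).bdry (n + 1))
    (hi : ∀ e ∈ (chains (lin k E)).cyc n,
      ap (linMap k a) _ e - ap (linMap k b) _ e ∈ (chains (lin k V)).bdry n →
        e ∈ (chains (lin k E)).bdry n) :
    (chains (lin k T)).cyc (n + 1) ≤ (chains (lin k T)).bdry (n + 1) := by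
  -- The case where both pieces are cycles. A cycle on the cylinder moves to the end `0`, hence into
  -- `V`; a cycle on `V` is homologous to some `a e - b e`, which bounds in `T` because the two ends
  -- of the cylinder are homotopic.
  have cyl (x : (chains (lin k (E ⊗ Δ[1]))).X (n + 1))
      (hx : x ∈ (chains (lin k (E ⊗ Δ[1]))).cyc (n + 1)) (y : (chains (lin k V)).X (n + 1))
      (hy : y ∈ (chains (lin k V)).cyc (n + 1)) :
      ap (linMap k i) _ x + ap (linMap k j) _ y ∈ (chains (lin k T)).bdry (n + 1) := by
    have hV (y : (chains (lin k V)).X (n + 1)) (hy : y ∈ (chains (lin k V)).cyc (n + 1)) :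
        ap (linMap k j) _ y ∈ (chains (lin k T)).bdry (n + 1) := by
      obtain ⟨e, he, hey⟩ := hs y hy
      have h₁ := ap_mem_bdry (linMap k j) hey
      have h₂ := ap_mem_bdry (linMap k i) (ap_sub_ap_mem_bdry
        (map_linMap_eq_of_toHo (k := k) (cylinderEndsHomotopy E).toHo_map_eq (n + 1)) he)
      rw [map_sub, ← ap_comp, ← ap_comp, ← linMap_comp, ← linMap_comp, h.comm₀, h.comm₁] at h₂
      rw [map_sub, map_sub, ← ap_comp, ← ap_comp, ← linMap_comp, ← linMap_comp] at h₁
      have := sub_mem h₂ h₁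
      rwa [sub_sub_cancel] at this
    have h₁ := ap_mem_bdry (linMap k i) (ap_sub_ap_mem_bdry
        (map_linMap_eq_of_toHo (k := k) (cylinderHomotopy E).toHo_map_eq (n + 1)) hx)
    rw [map_sub, ← ap_comp, ← linMap_comp, Category.assoc, h.comm₀, linMap_id, ap_id,
      ← Category.assoc, linMap_comp, ap_comp] at h₁
    have h₂ := hV _ (ap_mem_cyc (linMap k (CartesianMonoidalCategory.fst E Δ[1] ≫ a)) hx)
    have := add_mem (sub_mem h₂ h₁) (hV y hy)
    rwa [sub_sub_cancel] at this
  intro z hz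
  obtain ⟨x, y, rfl⟩ := exists_eq_ap_add_ap h (n + 1) z
  have hd : ap (linMap k i) n (del _ n x) + ap (linMap k j) n (del _ n y) = 0 := by
    rw [← del_ap, ← del_ap, ← map_add]
    exact hz
  -- The boundaries of the two pieces cancel along the ends, in `w₀` and `w₁`. Projecting to `E`
  -- shows that `w₀ + w₁` is a boundary, so `a w₀ - b w₀` is one too, and the injectivity hypothesis
  -- applies to `w₀`.
  obtain ⟨w₀, w₁, hw, hw'⟩ := exists_of_ap_add_ap_eq_zero h hd
  have hcyc : w₀ ∈ (chains (lin k E)).cyc n ∧ w₁ ∈ (chains (lin k E)).cyc n := by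
    cases n with
    | zero => exact ⟨mem_cyc_zero _, mem_cyc_zero _⟩
    | succ n =>
      refine eq_zero_of_ap_ι₀_add_ap_ι₁ (k := k) (w₀ := del _ n w₀) (w₁ := del _ n w₁) ?_
      rw [← del_ap, ← del_ap, ← map_add, hw, del_del]
  have hsum : w₀ + w₁ ∈ (chains (lin k E)).bdry n := by
    refine ⟨ap (linMap k (CartesianMonoidalCategory.fst E Δ[1])) _ x, ?_⟩
    refine (del_ap _ _ _).trans ?_
    rw [← hw, map_add, ← ap_comp, ← ap_comp, ← linMap_comp, ← linMap_comp, ι₀_fst, ι₁_fst,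
      linMap_id, ap_id, ap_id]
  have hw₀ : w₀ ∈ (chains (lin k E)).bdry n := by
    refine hi _ hcyc.1 ?_
    have h₁ : ap (linMap k a) n w₀ + ap (linMap k b) n w₁ ∈ (chains (lin k V)).bdry n := by
      rw [hw']
      exact neg_mem (d_mem_bdry y)
    have := sub_mem h₁ (ap_mem_bdry (linMap k b) hsum)
    rwa [map_add, add_sub_add_right_eq_sub] at this
  have hw₁ : w₁ ∈ (chains (lin k E)).bdry n := by
    have := sub_mem hsum hw₀
    rwa [add_sub_cancel_left] at this
  obtain ⟨s₀, rfl⟩ := hw₀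
  obtain ⟨s₁, rfl⟩ := hw₁
  change ap (linMap k ι₀) n (del _ n s₀) + ap (linMap k ι₁) n (del _ n s₁) = _ at hw
  change ap (linMap k a) n (del _ n s₀) + ap (linMap k b) n (del _ n s₁) = _ at hw'
  rw [← del_ap, ← del_ap, ← map_add] at hw hw'
  -- Transferring the chains `s₀` and `s₁` from the cylinder to `V` leaves the sum in `T` unchanged
  -- and makes both pieces cycles.
  have := cyl (x - (ap (linMap k ι₀) _ s₀ + ap (linMap k ι₁) _ s₁))
    (show del _ n _ = 0 by rw [map_sub, hw, sub_self])
    (y + (ap (linMap k a) _ s₀ + ap (linMap k b) _ s₁))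
    (show del _ n _ = 0 by rw [map_add, hw', add_neg_cancel])
  rw [map_sub, map_add, map_add, map_add, ← ap_comp, ← ap_comp, ← ap_comp, ← ap_comp,
    ← linMap_comp, ← linMap_comp, ← linMap_comp, ← linMap_comp, h.comm₀, h.comm₁,
    sub_add_add_cancel] at this
  exact this

end SimplicialModule

/-! ### Countable coproducts and the telescope of a zigzag -/

namespace SSet

/-- A simplicial set that is the coproduct of countably many copies of two simplicial sets. -/
structure IsNatCoprod {X Y E : SSet.{u}} (f : ℕ → (X ⟶ E)) (g : ℕ → (Y ⟶ E)) : Prop where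
  exists_desc : ∀ (T : SSet.{u}) (f' : ℕ → (X ⟶ T)) (g' : ℕ → (Y ⟶ T)),
    ∃ h : E ⟶ T, (∀ m, f m ≫ h = f' m) ∧ ∀ m, g m ≫ h = g' m
  exists_eq : ∀ (n : SimplexCategoryᵒᵖ) (e : E.obj n),
    (∃ m x, (f m).app n x = e) ∨ ∃ m y, (g m).app n y = e

end SSet

namespace SimplicialModule

open Opposite ChainComplex SSet

variable {k : Type} [Field k] {X Y E : SSet.{u}} {f : ℕ → (X ⟶ E)} {g : ℕ → (Y ⟶ E)}
  {A : SimplicialObject (ModuleCat.{u} k)}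

/-- The map to the underlying simplicial set of a simplicial module which is adjoint to a map from
a free simplicial module. -/
def linAdj (φ : lin k X ⟶ A) :
    X ⟶ ((SimplicialObject.whiskering _ _).obj (CategoryTheory.forget (ModuleCat.{u} k))).obj A where
  app n := ↾fun x => φ.app n (basisElt k x)
  naturality m n ψ := by
    ext x
    have h := congr($(φ.naturality ψ) (basisElt k x))
    exact (congrArg (φ.app n) (lin_map_basisElt ψ x)).symm.trans h

/-- The universal property is assumed for maps of simplicial sets; it passes to linear maps by the
adjunction between free and underlying objects. -/
lemma IsNatCoprod.exists_linDesc (h : IsNatCoprod f g) (φ : ℕ → (lin k X ⟶ A))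
    (ψ : ℕ → (lin k Y ⟶ A)) :
    ∃ θ : lin k E ⟶ A, (∀ m, linMap k (f m) ≫ θ = φ m) ∧ ∀ m, linMap k (g m) ≫ θ = ψ m := by
  obtain ⟨θ, h₁, h₂⟩ := h.exists_desc _ (fun m => linAdj (φ m)) (fun m => linAdj (ψ m))
  have hθ {m n : SimplexCategoryᵒᵖ} (χ : m ⟶ n) (x : E.obj m) :
      A.map χ (θ.app m x) = θ.app n (E.map χ x) := (NatTrans.naturality_apply θ χ x).symm
  refine ⟨linDesc (fun n x => θ.app n x) hθ, fun m => lin_hom_ext fun n x => ?_,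
    fun m => lin_hom_ext fun n x => ?_⟩
  · refine (congrArg ((linDesc (k := k) (fun n x => θ.app n x) hθ).app n)
      (linMap_basisElt (f m) x)).trans ?_
    exact (linDesc_basisElt _ hθ _).trans congr(($(h₁ m)).app n x)
  · refine (congrArg ((linDesc (k := k) (fun n x => θ.app n x) hθ).app n)
      (linMap_basisElt (g m) x)).trans ?_
    exact (linDesc_basisElt _ hθ _).trans congr(($(h₂ m)).app n x)

lemma IsNatCoprod.lin_hom_ext (h : IsNatCoprod f g) {φ ψ : lin k E ⟶ A}
    (h₁ : ∀ m, linMap k (f m) ≫ φ = linMap k (f m) ≫ ψ)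
    (h₂ : ∀ m, linMap k (g m) ≫ φ = linMap k (g m) ≫ ψ) : φ = ψ := by
  refine SimplicialModule.lin_hom_ext fun n e => ?_
  obtain ⟨m, x, rfl⟩ | ⟨m, x, rfl⟩ := h.exists_eq n e
  · rw [← linMap_basisElt]
    exact congr(($(h₁ m)).app n (basisElt k x))
  · rw [← linMap_basisElt]
    exact congr(($(h₂ m)).app n (basisElt k x))

/-- A chain on a countable coproduct is a finite sum of its components. -/
lemma IsNatCoprod.exists_sum_eq (h : IsNatCoprod f g) {r : ℕ → (lin k E ⟶ lin k X)}
    {s : ℕ → (lin k E ⟶ lin k Y)}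
    (hfr : ∀ i j, linMap k (f i) ≫ r j = if i = j then 𝟙 _ else 0)
    (hfs : ∀ i j, linMap k (f i) ≫ s j = 0) (hgr : ∀ i j, linMap k (g i) ≫ r j = 0)
    (hgs : ∀ i j, linMap k (g i) ≫ s j = if i = j then 𝟙 _ else 0)
    (n : ℕ) (w : (chains (lin k E)).X n) :
    ∃ N, ∑ m ∈ Finset.range N, (ap (linMap k (f m)) n (ap (r m) n w) +
      ap (linMap k (g m)) n (ap (s m) n w)) = w := by
  let L (N : ℕ) : (chains (lin k E)).X n →ₗ[k] (chains (lin k E)).X n :=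
    ∑ m ∈ Finset.range N, (ap (linMap k (f m)) n ∘ₗ ap (r m) n +
      ap (linMap k (g m)) n ∘ₗ ap (s m) n)
  have hL (N : ℕ) (w) : L N w = ∑ m ∈ Finset.range N, (ap (linMap k (f m)) n (ap (r m) n w) +
      ap (linMap k (g m)) n (ap (s m) n w)) := by
    simp only [L, LinearMap.sum_apply]
    rfl
  -- Asking for equality at all large `N` makes the condition stable under sums, so it can be
  -- checked on simplices.
  let W : Submodule k ((chains (lin k E)).X n) :=
    { carrier := {w | ∃ N, ∀ N' ≥ N, L N' w = w}
      add_mem' := by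
        rintro v w ⟨N₁, h₁⟩ ⟨N₂, h₂⟩
        refine ⟨max N₁ N₂, fun N hN => ?_⟩
        rw [map_add, h₁ _ (le_trans (le_max_left _ _) hN), h₂ _ (le_trans (le_max_right _ _) hN)]
      zero_mem' := ⟨0, fun _ _ => map_zero _⟩
      smul_mem' := by
        rintro c w ⟨N, h⟩
        exact ⟨N, fun N' hN' => by rw [map_smul, h _ hN']⟩ }
  suffices ⊤ ≤ W by
    obtain ⟨N, hN⟩ := this (Submodule.mem_top (x := w))
    exact ⟨N, (hL N w).symm.trans (hN N le_rfl)⟩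
  intro w _
  refine lin_range_le (𝟙 _) (op ⦋n⦌) W (fun e => ?_) w
  obtain ⟨m, x, rfl⟩ | ⟨m, x, rfl⟩ := h.exists_eq _ e
  · have hr (j : ℕ) : ap (r j) n (ap (linMap k (f m)) n (basisElt k x)) =
        if m = j then basisElt k x else 0 := by
      rw [← ap_comp, hfr]
      split_ifs <;> rfl
    have hs (j : ℕ) : ap (s j) n (ap (linMap k (f m)) n (basisElt k x)) = 0 := by
      rw [← ap_comp, hfs]
      rfl
    have : ap (linMap k (f m)) n (basisElt k x) ∈ W := by
      refine ⟨m + 1, fun N hN => ?_⟩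
      rw [hL, Finset.sum_eq_single m]
      · rw [hr, hs, if_pos rfl, map_zero, add_zero]
      · intro j _ hj
        rw [hr, hs, if_neg hj.symm, map_zero, map_zero, add_zero]
      · intro hm
        exact (hm (Finset.mem_range.2 (by omega))).elim
    exact linMap_basisElt (k := k) (f m) x ▸ this
  · have hr (j : ℕ) : ap (s j) n (ap (linMap k (g m)) n (basisElt k x)) =
        if m = j then basisElt k x else 0 := by
      rw [← ap_comp, hgs]
      split_ifs <;> rfl
    have hs (j : ℕ) : ap (r j) n (ap (linMap k (g m)) n (basisElt k x)) = 0 := by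
      rw [← ap_comp, hgr]
      rfl
    have : ap (linMap k (g m)) n (basisElt k x) ∈ W := by
      refine ⟨m + 1, fun N hN => ?_⟩
      rw [hL, Finset.sum_eq_single m]
      · rw [hr, hs, if_pos rfl, map_zero, zero_add]
      · intro j _ hj
        rw [hr, hs, if_neg hj.symm, map_zero, map_zero, add_zero]
      · intro hm
        exact (hm (Finset.mem_range.2 (by omega))).elim
    exact linMap_basisElt (k := k) (g m) x ▸ this

lemma IsNatCoprod.exists_retractions (k : Type) [Field k] (h : IsNatCoprod f g) :
    ∃ (r : ℕ → (lin k E ⟶ lin k X)) (s : ℕ → (lin k E ⟶ lin k Y)),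
      (∀ i j, linMap k (f i) ≫ r j = if i = j then 𝟙 _ else 0) ∧
      (∀ i j, linMap k (f i) ≫ s j = 0) ∧ (∀ i j, linMap k (g i) ≫ r j = 0) ∧
      ∀ i j, linMap k (g i) ≫ s j = if i = j then 𝟙 _ else 0 := by
  choose r h₁ h₂ using fun j : ℕ => IsNatCoprod.exists_linDesc (k := k) h
    (fun i => if i = j then 𝟙 (lin k X) else 0) (fun _ => 0)
  choose s h₃ h₄ using fun j : ℕ => IsNatCoprod.exists_linDesc (k := k) h
    (fun _ => 0) (fun i => if i = j then 𝟙 (lin k Y) else 0)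
  exact ⟨r, s, fun i j => h₁ j i, fun i j => h₃ j i, fun i j => h₂ j i, fun i j => h₄ j i⟩

/-- The gluing data of the mapping telescope of a zigzag `X ⟶ Y ⟵ C ⟶ X ⟶ Y ⟵ C ⟶ ⋯`. -/
structure _root_.SSet.IsZigzag {X Y C E V : SSet.{u}} (c : C ⟶ Y) (d : X ⟶ Y) (t : C ⟶ X)
    (f : ℕ → (X ⟶ E)) (g : ℕ → (C ⟶ E)) (f' : ℕ → (X ⟶ V)) (g' : ℕ → (Y ⟶ V))
    (a b : E ⟶ V) : Prop where
  edges : IsNatCoprod f g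
  vertices : IsNatCoprod f' g'
  f_a (m : ℕ) : f m ≫ a = f' m
  g_a (m : ℕ) : g m ≫ a = c ≫ g' m
  f_b (m : ℕ) : f m ≫ b = d ≫ g' m
  g_b (m : ℕ) : g m ≫ b = t ≫ f' (m + 1)

variable {C V : SSet.{u}} {c : C ⟶ Y} {d : X ⟶ Y} {t : C ⟶ X}
    {f : ℕ → (X ⟶ E)} {g : ℕ → (C ⟶ E)} {f' : ℕ → (X ⟶ V)} {g' : ℕ → (Y ⟶ V)}
    {a b : E ⟶ V}

/-- In components, `a - b` sends `(x_j, z_j)` to `x_0`, `x_(j+1) - t z_j` and `c z_j - d x_j`. This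
is triangular with isomorphisms on the diagonal in homology, so the components of `e` are boundaries
by induction along the zigzag. -/
lemma mem_bdry_of_isZigzag (h : IsZigzag c d t f g f' g' a b) {n : ℕ}
    (hc : IsIso ((H k n).map (linMap k c))) {e : (chains (lin k E)).X n}
    (he : e ∈ (chains (lin k E)).cyc n)
    (h₁ : ap (linMap k a) _ e - ap (linMap k b) _ e ∈ (chains (lin k V)).bdry n) :
    e ∈ (chains (lin k E)).bdry n := by
  obtain ⟨r, s, hfr, hfs, hgr, hgs⟩ := IsNatCoprod.exists_retractions k h.edges
  obtain ⟨r', s', hfr', hfs', hgr', hgs'⟩ := IsNatCoprod.exists_retractions k h.vertices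
  have e₀ : (linMap k a - linMap k b) ≫ r' 0 = r 0 := by
    refine IsNatCoprod.lin_hom_ext h.edges (fun m => ?_) (fun m => ?_)
    · rw [← Category.assoc, Preadditive.comp_sub, ← linMap_comp, ← linMap_comp, h.f_a, h.f_b,
        linMap_comp, Preadditive.sub_comp, Category.assoc, hfr', hgr', hfr, comp_zero, sub_zero]
    · rw [← Category.assoc, Preadditive.comp_sub, ← linMap_comp, ← linMap_comp, h.g_a, h.g_b,
        linMap_comp, linMap_comp, Preadditive.sub_comp, Category.assoc, Category.assoc, hfr', hgr',
        hgr, comp_zero, if_neg (Nat.succ_ne_zero m), comp_zero, sub_zero]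
  have e₁ (j : ℕ) : (linMap k a - linMap k b) ≫ r' (j + 1) = r (j + 1) - s j ≫ linMap k t := by
    refine IsNatCoprod.lin_hom_ext h.edges (fun m => ?_) (fun m => ?_)
    · rw [← Category.assoc, Preadditive.comp_sub, ← linMap_comp, ← linMap_comp, h.f_a, h.f_b,
        linMap_comp, Preadditive.sub_comp, Category.assoc, hfr', hgr', Preadditive.comp_sub,
        ← Category.assoc, hfs, hfr, comp_zero, zero_comp]
    · rw [← Category.assoc, Preadditive.comp_sub, ← linMap_comp, ← linMap_comp, h.g_a, h.g_b,
        linMap_comp, linMap_comp, Preadditive.sub_comp, Category.assoc, Category.assoc, hfr', hgr',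
        Preadditive.comp_sub, ← Category.assoc (linMap k (g m)), hgr, hgs, comp_zero]
      by_cases hmj : m = j <;> simp [hmj]
  have e₂ (j : ℕ) : (linMap k a - linMap k b) ≫ s' j = s j ≫ linMap k c - r j ≫ linMap k d := by
    refine IsNatCoprod.lin_hom_ext h.edges (fun m => ?_) (fun m => ?_)
    · rw [← Category.assoc, Preadditive.comp_sub, ← linMap_comp, ← linMap_comp, h.f_a, h.f_b,
        linMap_comp, Preadditive.sub_comp, Category.assoc, hfs', hgs', Preadditive.comp_sub,
        ← Category.assoc, ← Category.assoc, hfs, hfr]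
      by_cases hmj : m = j <;> simp [hmj]
    · rw [← Category.assoc, Preadditive.comp_sub, ← linMap_comp, ← linMap_comp, h.g_a, h.g_b,
        linMap_comp, linMap_comp, Preadditive.sub_comp, Category.assoc, Category.assoc, hfs', hgs',
        Preadditive.comp_sub, ← Category.assoc, ← Category.assoc, hgr, hgs]
      by_cases hmj : m = j <;> simp [hmj]
  have hD : ap (linMap k a - linMap k b) n e ∈ (chains (lin k V)).bdry n := h₁
  have hs (j : ℕ) (hr : ap (r j) n e ∈ (chains (lin k X)).bdry n) :
      ap (s j) n e ∈ (chains (lin k C)).bdry n := by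
    have := ap_mem_bdry (s' j) hD
    rw [← ap_comp, e₂, ap_sub, ap_comp, ap_comp] at this
    have := add_mem this (ap_mem_bdry (linMap k d) hr)
    rw [sub_add_cancel] at this
    exact @mem_bdry_of_isIso_homologyMap _ _ _ _ (chainsMap (linMap k c)) n hc _
      (ap_mem_cyc _ he) this
  have hr (j : ℕ) : ap (r j) n e ∈ (chains (lin k X)).bdry n := by
    induction j with
    | zero =>
      have := ap_mem_bdry (r' 0) hD
      rwa [← ap_comp, e₀] at this
    | succ j ih =>
      have := ap_mem_bdry (r' (j + 1)) hD
      rw [← ap_comp, e₁, ap_sub, ap_comp] at this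
      have := add_mem this (ap_mem_bdry (linMap k t) (hs j ih))
      rwa [sub_add_cancel] at this
  obtain ⟨N, hN⟩ := IsNatCoprod.exists_sum_eq h.edges hfr hfs hgr hgs n e
  rw [← hN]
  exact sum_mem fun j _ => add_mem (ap_mem_bdry _ (hr j)) (ap_mem_bdry _ (hs j (hr j)))

/-- Modulo the image of `a - b`, a class of the `m`-th copy of `X` equals its image under `P` in
copy `m + 1`, hence vanishes after `N` steps. Classes of `Y` lift through `c` and move into the next
copy of `X`. -/
lemma exists_of_isZigzag (h : IsZigzag c d t f g f' g' a b) {n : ℕ}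
    (hc : IsIso ((H k n).map (linMap k c))) {μ : Y ⟶ X} {P : End X} (hP : P = d ≫ μ)
    (hμ : (H k n).map (linMap k (c ≫ μ)) = (H k n).map (linMap k t)) {N : ℕ}
    (hN : Kills (linMap k (P ^ N : End X)) n) {y : (chains (lin k V)).X n}
    (hy : y ∈ (chains (lin k V)).cyc n) :
    ∃ e ∈ (chains (lin k E)).cyc n,
      ap (linMap k a) _ e - ap (linMap k b) _ e - y ∈ (chains (lin k V)).bdry n := by
  let S : Submodule k ((chains (lin k V)).X n) :=
    ((chains (lin k E)).cyc n).map (ap (linMap k a) n - ap (linMap k b) n) ⊔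
      (chains (lin k V)).bdry n
  suffices y ∈ S by
    obtain ⟨_, ⟨e, he, rfl⟩, v, hv, hev⟩ := Submodule.mem_sup.1 this
    refine ⟨e, he, ?_⟩
    rw [← hev]
    change ap (linMap k a) n e - ap (linMap k b) n e -
      (ap (linMap k a) n e - ap (linMap k b) n e + v) ∈ _
    rw [sub_add_cancel_left]
    exact neg_mem hv
  have hS {e : (chains (lin k E)).X n} (he : e ∈ (chains (lin k E)).cyc n) :
      ap (linMap k a) n e - ap (linMap k b) n e ∈ S := Submodule.mem_sup_left ⟨e, he, rfl⟩
  have hB {v : (chains (lin k V)).X n} (hv : v ∈ (chains (lin k V)).bdry n) : v ∈ S :=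
    Submodule.mem_sup_right hv
  have hlift {y : (chains (lin k Y)).X n} (hy : y ∈ (chains (lin k Y)).cyc n) :
      ∃ z ∈ (chains (lin k C)).cyc n, ap (linMap k c) n z - y ∈ (chains (lin k Y)).bdry n :=
    @exists_of_isIso_homologyMap _ _ _ _ (chainsMap (linMap k c)) n hc _ hy
  -- One step around the zigzag: `d x` is lifted through `c` to a cycle `z`, and `t z` is homologous
  -- to `P x` because `c ≫ μ` and `t` agree on homology.
  have hX (m : ℕ) {x : (chains (lin k X)).X n} (hx : x ∈ (chains (lin k X)).cyc n) :
      ap (linMap k (f' m)) n x - ap (linMap k (f' (m + 1))) n (ap (linMap k P) n x) ∈ S := by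
    obtain ⟨z, hz, hzx⟩ := hlift (ap_mem_cyc (linMap k d) hx)
    have h₁ := hS (ap_mem_cyc (linMap k (f m)) hx)
    have h₂ := hS (ap_mem_cyc (linMap k (g m)) hz)
    rw [← ap_comp, ← ap_comp, ← linMap_comp, ← linMap_comp, h.f_a, h.f_b, linMap_comp,
      ap_comp] at h₁
    rw [← ap_comp, ← ap_comp, ← linMap_comp, ← linMap_comp, h.g_a, h.g_b, linMap_comp,
      linMap_comp, ap_comp, ap_comp] at h₂
    have h₃ := hB (ap_mem_bdry (linMap k (g' m)) hzx)
    rw [map_sub] at h₃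
    have h₄ : ap (linMap k t) n z - ap (linMap k P) n x ∈ (chains (lin k X)).bdry n := by
      have h₅ := ap_sub_ap_mem_bdry hμ hz
      have h₆ := ap_mem_bdry (linMap k μ) hzx
      rw [map_sub, ← ap_comp, ← ap_comp, ← linMap_comp, ← linMap_comp, ← hP] at h₆
      have := sub_mem h₆ h₅
      rwa [sub_sub_sub_cancel_left] at this
    have h₅ := hB (ap_mem_bdry (linMap k (f' (m + 1))) h₄)
    rw [map_sub] at h₅
    have := add_mem (sub_mem (add_mem h₁ h₂) h₃) h₅
    convert this using 1
    abel
  have hXP (m N : ℕ) {x : (chains (lin k X)).X n} (hx : x ∈ (chains (lin k X)).cyc n) :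
      ap (linMap k (f' m)) n x -
        ap (linMap k (f' (m + N))) n (ap (linMap k (P ^ N : End X)) n x) ∈ S := by
    induction N with
    | zero =>
      rw [pow_zero, add_zero]
      have : ap (linMap k (1 : End X)) n x = x := congr(ap $(linMap_id X) n x)
      rw [this, sub_self]
      exact zero_mem _
    | succ N ih =>
      have h₁ := hX (m + N) (ap_mem_cyc (linMap k (P ^ N : End X)) hx)
      have h₂ : (P ^ (N + 1) : End X) = (P ^ N : End X) ≫ P := pow_succ' _ _
      rw [← ap_comp (linMap k (P ^ N : End X)) (linMap k P), ← linMap_comp, ← h₂] at h₁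
      have := add_mem ih h₁
      rwa [sub_add_sub_cancel] at this
  have hX' (m : ℕ) {x : (chains (lin k X)).X n} (hx : x ∈ (chains (lin k X)).cyc n) :
      ap (linMap k (f' m)) n x ∈ S := by
    have := add_mem (hXP m N hx) (hB (ap_mem_bdry (linMap k (f' (m + N)))
      (show ap (linMap k (P ^ N : End X)) n x ∈ _ from hN x hx)))
    rwa [sub_add_cancel] at this
  have hY (m : ℕ) {y : (chains (lin k Y)).X n} (hy : y ∈ (chains (lin k Y)).cyc n) :
      ap (linMap k (g' m)) n y ∈ S := by
    obtain ⟨z, hz, hzy⟩ := hlift hy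
    have h₂ := hS (ap_mem_cyc (linMap k (g m)) hz)
    rw [← ap_comp, ← ap_comp, ← linMap_comp, ← linMap_comp, h.g_a, h.g_b, linMap_comp,
      linMap_comp, ap_comp, ap_comp] at h₂
    have h₃ := hB (ap_mem_bdry (linMap k (g' m)) hzy)
    rw [map_sub] at h₃
    have := sub_mem (add_mem h₂ (hX' (m + 1) (ap_mem_cyc (linMap k t) hz))) h₃
    rwa [sub_add_cancel, sub_sub_cancel] at this
  obtain ⟨r', s', hfr', hfs', hgr', hgs'⟩ := IsNatCoprod.exists_retractions k h.vertices
  obtain ⟨M, hM⟩ := IsNatCoprod.exists_sum_eq h.vertices hfr' hfs' hgr' hgs' n y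
  rw [← hM]
  exact sum_mem fun j _ => add_mem (hX' j (ap_mem_cyc _ hy)) (hY j (ap_mem_cyc _ hy))

/-- The homology of the mapping telescope of a zigzag. -/
theorem cyc_le_bdry_of_isZigzag {T : SSet.{u}} (h : IsZigzag c d t f g f' g' a b)
    {i : E ⊗ Δ[1] ⟶ T} {j : V ⟶ T} (hT : IsHocoeq a b i j) (n : ℕ)
    (hc : ∀ n, IsIso ((H k n).map (linMap k c))) {μ : Y ⟶ X} {P : End X} (hP : P = d ≫ μ)
    (hμ : ∀ n, (H k n).map (linMap k (c ≫ μ)) = (H k n).map (linMap k t)) {N : ℕ}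
    (hN : Kills (linMap k (P ^ N : End X)) (n + 1)) :
    (chains (lin k T)).cyc (n + 1) ≤ (chains (lin k T)).bdry (n + 1) :=
  cyc_le_bdry_of_isHocoeq hT n (fun _ hy => exists_of_isZigzag h (hc _) hP (hμ _) hN hy)
    fun _ he h₁ => mem_bdry_of_isZigzag h (hc n) he h₁

end SimplicialModule

/-! ### Comparison with simplicial homology and the criterion for `π₀` -/

namespace SimplicialModule

open Opposite ChainComplex SSet

section Comparison

variable (k : Type) [Field k]

/-- The map from the free module on a set to a coproduct of copies of the base field. -/
def freeToSigma (S : Type u) :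
    ModuleCat.of k (S →₀ k) ⟶ ∐ fun _ : S => ModuleCat.of k (ULift.{u} k) :=
  ModuleCat.ofHom (Finsupp.lsum k fun s =>
    (Sigma.ι (fun _ : S => ModuleCat.of k (ULift.{u} k)) s).hom ∘ₗ
      (ULift.moduleEquiv (R := k) (M := k)).symm.toLinearMap)

/-- The map from a coproduct of copies of the base field to the free module. -/
def sigmaToFree (S : Type u) :
    (∐ fun _ : S => ModuleCat.of k (ULift.{u} k)) ⟶ ModuleCat.of k (S →₀ k) :=
  Limits.Sigma.desc fun s => ModuleCat.ofHom
    (Finsupp.lsingle s ∘ₗ (ULift.moduleEquiv (R := k) (M := k)).toLinearMap)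

lemma freeToSigma_single {S : Type u} (s : S) (r : k) :
    freeToSigma k S (Finsupp.single s r) =
      Sigma.ι (fun _ : S => ModuleCat.of k (ULift.{u} k)) s (ULift.up r) :=
  Finsupp.lsum_single k _ s r

lemma sigmaToFree_ι {S : Type u} (s : S) (r : ULift.{u} k) :
    sigmaToFree k S (Sigma.ι (fun _ : S => ModuleCat.of k (ULift.{u} k)) s r) =
      Finsupp.single s r.down :=
  congr($(Sigma.ι_desc (fun s : S => ModuleCat.ofHom
    (Finsupp.lsingle s ∘ₗ (ULift.moduleEquiv (R := k) (M := k)).toLinearMap)) s) r)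

/-- The free module on a set is a coproduct. -/
def freeModuleIso : freeModule.{u} k ≅ sigmaConst.obj (ModuleCat.of k (ULift.{u} k)) :=
  NatIso.ofComponents (fun S =>
    { hom := freeToSigma k S
      inv := sigmaToFree k S
      hom_inv_id := ModuleCat.hom_ext (Finsupp.lhom_ext' fun s => LinearMap.ext_ring
        ((congrArg (sigmaToFree k S) (freeToSigma_single k s 1)).trans (sigmaToFree_ι k s _)))
      inv_hom_id := Sigma.hom_ext _ _ fun s => ModuleCat.hom_ext (LinearMap.ext fun r =>
        (congrArg (freeToSigma k S) (sigmaToFree_ι k s r)).trans (freeToSigma_single k s _)) })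
    fun {S S'} f => by
    refine ModuleCat.hom_ext (Finsupp.lhom_ext' fun s => LinearMap.ext_ring ?_)
    have h₁ : freeToSigma k S' (Finsupp.mapDomain f (Finsupp.single s 1)) =
        Sigma.ι (fun _ : S' => ModuleCat.of k (ULift.{u} k)) (f s) (ULift.up 1) := by
      rw [Finsupp.mapDomain_single, freeToSigma_single]
    have h₂ : Sigma.ι (fun _ : S => ModuleCat.of k (ULift.{u} k)) s ≫
        Limits.Sigma.map' f (fun _ => 𝟙 _) =
          Sigma.ι (fun _ : S' => ModuleCat.of k (ULift.{u} k)) (f s) := by simp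
    exact h₁.trans (congr($h₂ (ULift.up 1)).symm.trans
      (congrArg ((sigmaConst.obj (ModuleCat.of k (ULift.{u} k))).map f)
        (freeToSigma_single k s 1)).symm)

/-- Simplicial homology is defined with coproducts of copies of the coefficients, the arguments here
with finitely supported functions; `freeModuleIso` identifies the two naturally. -/
lemma isIso_homologyMap_iff {X Y : SSet.{u}} (f : X ⟶ Y) (n : ℕ) :
    IsIso (SSet.homologyMap f (ModuleCat.of k (ULift.{u} k)) n) ↔
      IsIso ((H k n).map (linMap k f)) := by
  let α : linFunctor k ⋙ AlgebraicTopology.alternatingFaceMapComplex _ ≅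
      (SSet.chainComplexFunctor _).obj (ModuleCat.of k (ULift.{u} k)) :=
    Functor.isoWhiskerRight ((SimplicialObject.whiskering _ _).mapIso (freeModuleIso k)) _
  let β := Functor.isoWhiskerRight α (HomologicalComplex.homologyFunctor _ _ n)
  exact (NatIso.isIso_map_iff β f).symm

end Comparison

variable {k : Type} [Field k]

lemma isIso_map_linMap_of_toHo {X Y : SSet.{u}} {f : X ⟶ Y} (hf : IsIso (toHo.map f)) (n : ℕ) :
    IsIso ((H k n).map (linMap k f)) := by
  rw [← isIso_homologyMap_iff]
  exact isIso_homologyMap_of_toHo _ _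

/-- A simplicial set whose homology vanishes in positive degrees has the homology of its set of
connected components. -/
lemma isIso_map_linMap_toPi0 {X : SSet.{u}}
    (hX : ∀ n, (chains (lin k X)).cyc (n + 1) ≤ (chains (lin k X)).bdry (n + 1)) (n : ℕ) :
    IsIso ((H k n).map (linMap k X.toPi0)) := by
  -- The section is a strict right inverse of the map to `π₀`; it remains to see that the collapse
  -- is the identity on homology.
  have h : Kills (𝟙 (lin k X) - linMap k X.collapsePi0) n := by
    cases n with
    | zero => exact kills_id_sub_linMap_collapsePi0
    | succ n => exact fun z hz => hX n (map_mem_cyc _ hz)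
  rw [kills_iff_map_eq_zero, Functor.map_sub, sub_eq_zero] at h
  refine ⟨(H k n).map (linMap k X.pi0Section), ?_, ?_⟩
  · rw [← CategoryTheory.Functor.map_comp, ← linMap_comp]
    exact h.symm.trans (CategoryTheory.Functor.map_id _ _)
  · rw [← CategoryTheory.Functor.map_comp, ← linMap_comp, pi0Section_toPi0, linMap_id,
      CategoryTheory.Functor.map_id]

end SimplicialModule

/-! ### The telescope as a concrete gluing -/

namespace GammaObj

open SSet

/-- Evaluation of a functor on finite pointed sets at an object and a degree. -/
abbrev evalSimplices (S : FinPtd) (n : SimplexCategoryᵒᵖ) : GammaObj.{u} ⥤ Type u :=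
  (evaluation FinPtd SSet.{u}).obj S ⋙ (evaluation SimplexCategoryᵒᵖ (Type u)).obj n

/-- Evaluation at an object and a degree preserves colimits, so the pushout becomes one of sets. -/
lemma isHocoeq_hocoeq {X Y : GammaObj.{u}} (a b : X ⟶ Y) (S : FinPtd) :
    IsHocoeq (a.app S) (b.app S)
      ((pushout.inl (coprod.desc X.cyl₀ X.cyl₁) (coprod.desc a b)).app S : _ ⟶ (hocoeq a b).obj S)
      ((pushout.inr (coprod.desc X.cyl₀ X.cyl₁) (coprod.desc a b)).app S) := by
  have hp := IsPushout.of_hasPushout (coprod.desc X.cyl₀ X.cyl₁) (coprod.desc a b)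
  have h₀ : X.cyl₀ ≫ pushout.inl (coprod.desc X.cyl₀ X.cyl₁) (coprod.desc a b) =
      a ≫ pushout.inr (coprod.desc X.cyl₀ X.cyl₁) (coprod.desc a b) := by
    have := congr(coprod.inl ≫ $(hp.w))
    rwa [coprod.inl_desc_assoc, coprod.inl_desc_assoc] at this
  have h₁ : X.cyl₁ ≫ pushout.inl (coprod.desc X.cyl₀ X.cyl₁) (coprod.desc a b) =
      b ≫ pushout.inr (coprod.desc X.cyl₀ X.cyl₁) (coprod.desc a b) := by
    have := congr(coprod.inr ≫ $(hp.w))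
    rwa [coprod.inr_desc_assoc, coprod.inr_desc_assoc] at this
  refine ⟨congr(($h₀).app S), congr(($h₁).app S), fun n Q f g hf hg => ?_, fun n t => ?_⟩
  · have hpn := hp.map (evalSimplices S n)
    have hc := mapIsColimitOfPreservesOfIsColimit (evalSimplices.{u} S n)
      (coprod.inl : X ⟶ X ⨿ X) coprod.inr (coprodIsCoprod X X)
    have w : (evalSimplices S n).map (coprod.desc X.cyl₀ X.cyl₁) ≫ (↾f) =
        (evalSimplices S n).map (coprod.desc a b) ≫ (↾g) := by
      refine BinaryCofan.IsColimit.hom_ext hc ?_ ?_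
      · change (evalSimplices S n).map coprod.inl ≫ _ = (evalSimplices S n).map coprod.inl ≫ _
        rw [← CategoryTheory.Functor.map_comp_assoc, ← CategoryTheory.Functor.map_comp_assoc,
          coprod.inl_desc, coprod.inl_desc]
        ext x
        exact hf x
      · change (evalSimplices S n).map coprod.inr ≫ _ = (evalSimplices S n).map coprod.inr ≫ _
        rw [← CategoryTheory.Functor.map_comp_assoc, ← CategoryTheory.Functor.map_comp_assoc,
          coprod.inr_desc, coprod.inr_desc]
        ext x
        exact hg x
    exact ⟨hpn.desc (↾f) (↾g) w, fun x => congr($(hpn.inl_desc (↾f) (↾g) w) x),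
      fun x => congr($(hpn.inr_desc (↾f) (↾g) w) x)⟩
  · have hpn := hp.map (evalSimplices S n)
    -- Joint surjectivity from uniqueness in the universal property: the indicator of the union of
    -- the images and the constant `True` agree on both pieces.
    let φ : (evalSimplices S n).obj (hocoeq a b) ⟶ ULift.{u} Prop := ↾fun t => ULift.up
      ((∃ x, (evalSimplices S n).map
      (pushout.inl (coprod.desc X.cyl₀ X.cyl₁) (coprod.desc a b)) x = t) ∨
      ∃ y, (evalSimplices S n).map
        (pushout.inr (coprod.desc X.cyl₀ X.cyl₁) (coprod.desc a b)) y = t)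
    let ψ : (evalSimplices S n).obj (hocoeq a b) ⟶ ULift.{u} Prop := ↾fun _ => ULift.up True
    have : φ = ψ := by
      refine hpn.hom_ext ?_ ?_
      · refine ConcreteCategory.hom_ext _ _ fun x => ?_
        have : φ ((evalSimplices S n).map (pushout.inl _ _) x) = ULift.up True :=
          congrArg ULift.up (eq_true (Or.inl ⟨x, rfl⟩))
        exact this
      · refine ConcreteCategory.hom_ext _ _ fun x => ?_
        have : φ ((evalSimplices S n).map (pushout.inr _ _) x) = ULift.up True :=
          congrArg ULift.up (eq_true (Or.inr ⟨x, rfl⟩))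
        exact this
    have h₂ : φ t = ψ t := congr($this t)
    exact of_eq_true (congrArg ULift.down h₂)

lemma isNatCoprod_sigma (A B : GammaObj.{u}) (S : FinPtd) :
    IsNatCoprod (fun m => (coprod.inl ≫ Sigma.ι (fun _ : ℕ => A ⨿ B) m).app S)
      (fun m => (coprod.inr ≫ Sigma.ι (fun _ : ℕ => A ⨿ B) m).app S) where
  exists_desc T f g := by
    let F := (evaluation FinPtd SSet.{u}).obj S
    have hc := mapIsColimitOfPreservesOfIsColimit F (coprod.inl : A ⟶ A ⨿ B) coprod.inr
      (coprodIsCoprod A B)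
    have hs := isColimitCofanMkObjOfIsColimit F (fun _ : ℕ => A ⨿ B) _
      (coproductIsCoproduct (fun _ : ℕ => A ⨿ B))
    refine ⟨Cofan.IsColimit.desc hs fun m => BinaryCofan.IsColimit.desc hc (f m) (g m), fun m => ?_,
      fun m => ?_⟩
    · change (F.map coprod.inl ≫ F.map (Sigma.ι (fun _ : ℕ => A ⨿ B) m)) ≫ _ = _
      rw [Category.assoc]
      exact (congrArg (F.map coprod.inl ≫ ·) (Cofan.IsColimit.fac hs _ m)).trans
        (BinaryCofan.IsColimit.inl_desc hc _ _)
    · change (F.map coprod.inr ≫ F.map (Sigma.ι (fun _ : ℕ => A ⨿ B) m)) ≫ _ = _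
      rw [Category.assoc]
      exact (congrArg (F.map coprod.inr ≫ ·) (Cofan.IsColimit.fac hs _ m)).trans
        (BinaryCofan.IsColimit.inr_desc hc _ _)
  exists_eq n e := by
    let F := evalSimplices.{u} S n
    have hc := mapIsColimitOfPreservesOfIsColimit F (coprod.inl : A ⟶ A ⨿ B) coprod.inr
      (coprodIsCoprod A B)
    have hs := isColimitCofanMkObjOfIsColimit F (fun _ : ℕ => A ⨿ B) _
      (coproductIsCoproduct (fun _ : ℕ => A ⨿ B))
    let φ : F.obj (∐ fun _ : ℕ => A ⨿ B) ⟶ ULift.{u} Prop := ↾fun t => ULift.up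
      ((∃ m x, F.map (coprod.inl ≫ Sigma.ι (fun _ : ℕ => A ⨿ B) m) x = t) ∨
        ∃ m x, F.map (coprod.inr ≫ Sigma.ι (fun _ : ℕ => A ⨿ B) m) x = t)
    let ψ : F.obj (∐ fun _ : ℕ => A ⨿ B) ⟶ ULift.{u} Prop := ↾fun _ => ULift.up True
    have : φ = ψ := by
      refine Cofan.IsColimit.hom_ext hs _ _ fun m => BinaryCofan.IsColimit.hom_ext hc ?_ ?_
      · refine ConcreteCategory.hom_ext _ _ fun x => ?_
        have : φ (F.map (coprod.inl ≫ Sigma.ι (fun _ : ℕ => A ⨿ B) m) x) = ULift.up True :=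
          congrArg ULift.up (eq_true (Or.inl ⟨m, x, rfl⟩))
        rw [CategoryTheory.Functor.map_comp] at this
        exact this
      · refine ConcreteCategory.hom_ext _ _ fun x => ?_
        have : φ (F.map (coprod.inr ≫ Sigma.ι (fun _ : ℕ => A ⨿ B) m) x) = ULift.up True :=
          congrArg ULift.up (eq_true (Or.inr ⟨m, x, rfl⟩))
        rw [CategoryTheory.Functor.map_comp] at this
        exact this
    have h : φ e = ψ e := congr($this e)
    exact of_eq_true (congrArg ULift.down h)

variable (M : GammaObj.{u}) (p : ℕ)

lemma isZigzag_tel (S : FinPtd) :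
    IsZigzag ((M.comparison p).app S) ((M.diag p).app S) ((M.add p).app S)
      (fun m => (coprod.inl ≫ Sigma.ι (fun _ : ℕ => M ⨿ M.onCopies p) m).app S)
      (fun m => (coprod.inr ≫ Sigma.ι (fun _ : ℕ => M ⨿ M.onCopies p) m).app S)
      (fun m => (M.ιM p m).app S) (fun m => (M.ιPower p m).app S)
      ((M.telLeft p).app S) ((M.telRight p).app S) where
  edges := isNatCoprod_sigma _ _ S
  vertices := isNatCoprod_sigma _ _ S
  f_a m := by
    rw [← NatTrans.comp_app, telLeft, Category.assoc, Sigma.ι_desc, coprod.inl_desc]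
  g_a m := by
    rw [← NatTrans.comp_app, telLeft, Category.assoc, Sigma.ι_desc, coprod.inr_desc]
    rfl
  f_b m := by
    rw [← NatTrans.comp_app, telRight, Category.assoc, Sigma.ι_desc, coprod.inl_desc]
    rfl
  g_b m := by
    rw [← NatTrans.comp_app, telRight, Category.assoc, Sigma.ι_desc, coprod.inr_desc]
    rfl

/-- The values of a power are powers. -/
def powerIsoPow (S : FinPtd) : (M.power p).obj S ≅ (M.obj S).pow (Fin p) :=
  PreservesProduct.iso ((evaluation FinPtd SSet.{u}).obj S) (fun _ : Fin p => M) ≪≫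
    piIsoPow (M.obj S) (Fin p)

lemma powerIsoPow_hom_powπ (S : FinPtd) (i : Fin p) :
    (M.powerIsoPow p S).hom ≫ powπ (M.obj S) i = (Pi.π (fun _ : Fin p => M) i).app S := by
  rw [powerIsoPow, Iso.trans_hom, Category.assoc]
  exact piComparison_comp_π ((evaluation FinPtd SSet.{u}).obj S) (fun _ : Fin p => M) i

lemma comparison_app_comp_powerIsoPow_hom (S : FinPtd) :
    (M.comparison p).app S ≫ (M.powerIsoPow p S).hom = M.comparisonPow p S :=
  pow_hom_ext fun i => by
    rw [Category.assoc, powerIsoPow_hom_powπ, ← NatTrans.comp_app, comparison, Pi.lift_π]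
    rfl

lemma diag_app_comp_powerIsoPow_hom (S : FinPtd) :
    (M.diag p).app S ≫ (M.powerIsoPow p S).hom = powDiag (M.obj S) (Fin p) :=
  pow_hom_ext fun i => by
    rw [Category.assoc, powerIsoPow_hom_powπ, ← NatTrans.comp_app, diag, Pi.lift_π]
    rfl

end GammaObj

/-! ### Conclusion -/

open SimplicialModule SSet

/-- The mod `p` homology of the `p`-telescope vanishes in positive degrees. -/
lemma CommMonoidSpace.cyc_le_bdry_tel (p : ℕ) [hp : Fact p.Prime] (M : CommMonoidSpace.{u})
    (n : ℕ) :
    (chains (lin (ZMod p) (M.tel p).underlying)).cyc (n + 1) ≤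
      (chains (lin (ZMod p) (M.tel p).underlying)).bdry (n + 1) := by
  obtain ⟨μ, h₁, h₂, h₃⟩ := M.exists_add p
  let P : End M.toFunctor.underlying := powDiag _ (Fin p) ≫ μ
  -- The degrees covered lie strictly below the bound, so `n + 2` is needed to reach degree `n + 1`.
  obtain ⟨N, hN⟩ := exists_kills_pow (k := ZMod p) hp.out (P := P) rfl
    (fun n => map_linMap_eq_of_toHo h₂ n) (fun n σ => map_linMap_eq_of_toHo (h₃ σ) n) (n + 2)
  refine cyc_le_bdry_of_isZigzag (M.toFunctor.isZigzag_tel p FinPtd.one)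
    (GammaObj.isHocoeq_hocoeq _ _ FinPtd.one) n (fun n => ?_)
    (μ := (M.toFunctor.powerIsoPow p FinPtd.one).hom ≫ μ) (P := P) ?_ (fun n => ?_)
    (hN (n + 1) (by omega) (by omega))
  · refine isIso_map_linMap_of_toHo ?_ n
    have h := M.toFunctor.comparison_app_comp_powerIsoPow_hom p FinPtd.one
    have h₄ : IsIso (toHo.map ((M.toFunctor.comparison p).app FinPtd.one ≫
        (M.toFunctor.powerIsoPow p FinPtd.one).hom)) := by
      rw [h]
      infer_instance
    rw [CategoryTheory.Functor.map_comp] at h₄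
    exact IsIso.of_isIso_comp_right _ (toHo.map (M.toFunctor.powerIsoPow p FinPtd.one).hom)
  · rw [← Category.assoc, GammaObj.diag_app_comp_powerIsoPow_hom]
  · rw [← Category.assoc, GammaObj.comparison_app_comp_powerIsoPow_hom]
    exact map_linMap_eq_of_toHo h₁ n

end

theorem theorem5p1 (p : ℕ) [Fact p.Prime] (M : CommMonoidSpace.{u}) :
    SSet.IsFpHomologyIso p (SSet.toPi0 (M.tel p).underlying) := fun n =>
  (SimplicialModule.isIso_homologyMap_iff (ZMod p) _ n).2
    (SimplicialModule.isIso_map_linMap_toPi0 (M.cyc_le_bdry_tel p) n)
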